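/- Consider the following process on finite integer sequences $S=(a_\ell,a_{\ell-1},\dots,a_1,a_0)$ with $\ell\ge 1$. The next state $P(S)$ is given by exactly one of these rules. - Overflow: if $a_\ell$ is odd and $a_{\ell-1},\dots,a_0$ are even, then $P(S)=(0,a_\ell+1,a_{\ell-1},\dots,a_0)$. - Halt: if all $a_i$ are even and $a_\ell=a_{\ell-1}=0$, the process halts. - Zero: if all $a_i$ are even and $(a_\ell,a_{\ell-1})\neq(0,0)$, then $P(S)=(0,0,a_\ell+1,a_{\ell-1},\dots,a_1,a_0-1)$. - Halve: if none of the above applies and $a_0=-1$, then $P(S)=(a_\ell,\dots,a_1)$. - Increment: otherwise, let $i$ be the least index with $a_i$ odd; $P(S)$ is obtained from $S$ by increasing $a_{i+1}$ by $1$ and decreasing $a_0$ by $1$. For $k\ge 1$ let $S_k=(0,2,4,\dots,2^{2k},0)$, where the entries between the two zeros are $2^1,2^2,\dots,2^{2k}$; in particular $S_1=(0,2,4,0)$. Then for every $k\ge 1$ there is $m\in\mathbb{N}$ with $P^m(S_k)=S_{k+1}$, and exactly one of the $m$ rules applied on the way from $S_k$ to $S_{k+1}$ is an Overflow. Consequently,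 started from any $S_k$ with $k\ge 1$ (in particular from $(0,2,4,0)$), the process runs forever and never reaches Halt. Moreover the 5-state, 2-symbol Turing machine Skelet #17, with transition table $$\begin{array}{c|ccccc} & A & B & C & D & E\\ \hline 0 & 1RB & 0LC & 0LD & 1RA & 0RB\\ 1 & \text{(undefined)} & 1RE & 1LC & 1LB & 0RA\end{array}$$ (symbol written, direction of the move, new state), started in state $A$ on the all-$0$ tape, never halts, that is, it never reaches the undefined entry (state $A$ reading $1$). -/

import Mathlib

namespace Skelet17

/-! ### Iterating a partial step function -/

/-- The result of `n` successive applications of the partial step function `f` to `a`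
(`none` if one of these applications is not possible). -/
def iter {α : Type} (f : α → Option α) : ℕ → α → Option α
  | 0, a => some a
  | n + 1, a => (f a).bind (iter f n)

/-- Started at `a`, the iteration of `f` stops after finitely many steps. -/
def Halts {α : Type} (f : α → Option α) (a : α) : Prop :=
  ∃ n : ℕ, iter f n a = none

/-! ### The counter process -/

/-- A state `(a_ℓ, …, a_1, a_0)` of the counter process, stored with the index `0` first:
the entry of the list at position `i` is `a_i`, so the list is `[a_0, a_1, …, a_ℓ]`. -/
abbrev State := List ℤ

/-- The entry `a_i`. -/
def entry (S : State) (i : ℕ) : ℤ := S.getD i 0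

/-- The top index `ℓ`, one less than the number of entries. -/
def top (S : State) : ℕ := S.length - 1

/-- The names of the five rules. -/
inductive Rule where
  | overflow
  | halt
  | zero
  | halve
  | increment
  deriving DecidableEq

/-- The rule that applies to a state. States have at least two entries; no rule applies to
shorter lists. -/
def rule (S : State) : Option Rule :=
  if S.length < 2 then none
  else if Odd (entry S (top S)) ∧ ∀ i < top S, Even (entry S i) then some Rule.overflow
  else if ∀ i ≤ top S, Even (entry S i) then
    if entry S (top S) = 0 ∧ entry S (top S - 1) = 0 then some Rule.halt
    else some Rule.zero
  else if entry S 0 = -1 then some Rule.halve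
  else some Rule.increment

/-- The effect of a rule on a state to which it applies.
* Overflow: `(a_ℓ, a_{ℓ-1}, …, a_0)` becomes `(0, a_ℓ + 1, a_{ℓ-1}, …, a_0)`.
* Halt: there is no next state.
* Zero: `(a_ℓ, a_{ℓ-1}, …, a_0)` becomes `(0, 0, a_ℓ + 1, a_{ℓ-1}, …, a_1, a_0 - 1)`.
* Halve: `(a_ℓ, …, a_1, a_0)` becomes `(a_ℓ, …, a_1)`.
* Increment: `a_{i+1}` goes up by one, where `i` is the least index of an odd entry, and `a_0`
  goes down by one. -/
def applyRule : Rule → State → Option State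
  | Rule.overflow, S => some (S.modify (top S) (· + 1) ++ [0])
  | Rule.halt, _ => none
  | Rule.zero, S => some ((S.modify (top S) (· + 1)).modify 0 (· - 1) ++ [0, 0])
  | Rule.halve, S => some S.tail
  | Rule.increment, S =>
      some ((S.modify (S.findIdx (fun a => decide (Odd a)) + 1) (· + 1)).modify 0 (· - 1))

/-- The next state `P(S)`; it is undefined exactly when Halt applies (or `S` has fewer than two
entries, so that no rule applies). -/
def P (S : State) : Option State := (rule S).bind fun r => applyRule r S

/-- The rules applied in the first `n` steps of the process started at `S`, in order. -/
def rulesApplied : ℕ → State → List Rule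
  | 0, _ => []
  | n + 1, S => (rule S).toList ++ (P S).elim [] (rulesApplied n)

/-- The state `S_k = (0, 2, 4, …, 2^{2k}, 0)`, written with the top entry first and then reversed
to fit the storage order. -/
def counterState (k : ℕ) : State :=
  ([0] ++ (List.range (2 * k)).map (fun j => (2 : ℤ) ^ (j + 1)) ++ [0]).reverse

/-- `S_1` is the state `(0, 2, 4, 0)` in which the process begins. -/
theorem counterState_one : counterState 1 = [0, 2, 4, 0].reverse := by decide

/-! ### The Turing machine -/

/-- The five states of the machine. -/
inductive Q where
  | A
  | B
  | C
  | D
  | E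

/-- The transition table of Skelet #17, `1RB---_0LC1RE_0LD1LC_1RA1LB_0RB0RA`: symbol to write,
direction of the move, new state. The symbols `0`, `1` are `false`, `true`; the blank is `0`. -/
def table : Q → Bool → Option (Bool × Turing.Dir × Q)
  | Q.A, false => some (true, Turing.Dir.right, Q.B)
  | Q.A, true => none
  | Q.B, false => some (false, Turing.Dir.left, Q.C)
  | Q.B, true => some (true, Turing.Dir.right, Q.E)
  | Q.C, false => some (false, Turing.Dir.left, Q.D)
  | Q.C, true => some (true, Turing.Dir.left, Q.C)
  | Q.D, false => some (true, Turing.Dir.right, Q.A)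
  | Q.D, true => some (true, Turing.Dir.left, Q.B)
  | Q.E, false => some (false, Turing.Dir.right, Q.B)
  | Q.E, true => some (false, Turing.Dir.right, Q.A)

/-- A configuration: the current state and the two-sided infinite tape with its head. -/
structure Cfg where
  state : Q
  tape : Turing.Tape Bool

/-- One move of the machine; `none` if the table has no entry, that is, if the machine halts. -/
def step (c : Cfg) : Option Cfg :=
  (table c.state c.tape.head).map fun t => ⟨t.2.2, (c.tape.write t.1).move t.2.1⟩

/-- The initial configuration: state `A` on the blank tape. -/
def initial : Cfg := ⟨Q.A, Turing.Tape.mk₁ []⟩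

end Skelet17

namespace Skelet17

/-! While only Increment applies, the parities of the entries run through the reflected Gray code.
Moving to position `y` raises the entry at index `s + 1`, where `2 ^ s` is the exact power of two in
`y` (`carry_pow_mul_odd`), so `d` increments from position `N` add `carry i (N + d) - carry i N` to
entry `i ≥ 1` (`path_advance`). Halve turns position `2 * N` into `-1 - N` (`Coherent.tail`), and
Zero restarts the count at `-2 ^ L` (`coherent_zeroed`).

Hence a round (Zero, two Halves, increments up to position `-1`) leads from an all-even state to an
all-even state of the same length. Write such states as `base L + 2 * D`; the states `S_k` have `D =
0`. A round maps `D` to `next L D` (`round_full`), and along the orbit this adds one at a single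
index `f` (`Inv`). An index `f ≥ 2` is followed by `f - 2`. After `0` or `1` comes `s` or `s + 1`,
where `2 ^ s` is the exact power of two in the new value at `f`; if that value is `D 1 = 0`, the top
index comes next. So the parity of `f` changes only at values with odd exponent. Counting these by
`ev` couples `D 0` and `D 1`: with `l = L - 1`, when `D 1` reaches `2 ^ l`, `D 0` is `2 ^ l - 2`
(`exists_path_isLast`). The other differences are then forced (`Inv.isLast`), and the next round
runs into Overflow (`path_overflow_round`). It leaves a few negative differences at odd indices,
which later rounds fill up (`path_zeroed_zero`), and this gives `S_{k+1}`.

On the tape an entry is a block of pairs `10`. A sweep to the first odd block and back performs a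
rule, except that Halve is free and Overflow is done together with the following Zero. `Path`
carries the run of the process and that of the machine along together; an infinite chain of nonempty
runs excludes halting (`not_halts_of_chain`). -/

theorem iter_add {α : Type} (f : α → Option α) (m n : ℕ) (a : α) :
    iter f (m + n) a = (iter f m a).bind (iter f n) := by
  induction m generalizing a with
  | zero => simp [iter]
  | succ m ih =>
    rw [Nat.succ_add]
    simp only [iter]
    cases f a <;> simp [ih]

theorem not_halts_of_chain {α : Type} {f : α → Option α} (s : ℕ → α)
    (h : ∀ k, ∃ m, 0 < m ∧ iter f m (s k) = some (s (k + 1))) (k : ℕ) : ¬ Halts f (s k) := by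
  rintro ⟨n, hn⟩
  induction n using Nat.strong_induction_on generalizing k with
  | _ n ih =>
    obtain ⟨m, hm, h1⟩ := h k
    rcases le_total m n with hmn | hmn
    · obtain ⟨r, rfl⟩ := Nat.exists_eq_add_of_le hmn
      rw [iter_add, h1] at hn
      exact ih r (by omega) (k + 1) hn
    · obtain ⟨r, rfl⟩ := Nat.exists_eq_add_of_le hmn
      rw [iter_add, hn] at h1
      simp at h1

/-! ### Runs of the machine -/

/-- The machine gets from `c` to `d` in finitely many moves. -/
def Reach (c d : Cfg) : Prop := ∃ n, iter step n c = some d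

theorem Reach.refl (c : Cfg) : Reach c c := ⟨0, rfl⟩

theorem Reach.trans {c d e : Cfg} (h : Reach c d) (h' : Reach d e) : Reach c e := by
  obtain ⟨m, hm⟩ := h
  obtain ⟨n, hn⟩ := h'
  exact ⟨m + n, by rw [iter_add, hm]; exact hn⟩

theorem Reach.head {c d e : Cfg} (h : step c = some d) (h' : Reach d e) : Reach c e :=
  Reach.trans ⟨1, by simp [iter, h]⟩ h'

/-- The configuration in state `q` with the cells `l` to the left of the head (nearest first)
and the cells `r` from the head on to the right. -/
def mr (q : Q) (l r : List Bool) : Cfg :=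
  ⟨q, Turing.Tape.mk' (Turing.ListBlank.mk l) (Turing.ListBlank.mk r)⟩

/-- The configuration in state `q` with the head on the first of the cells `l` (which extend to
the left, nearest first) and the cells `r` to the right of the head. -/
def ml (q : Q) (l r : List Bool) : Cfg := mr q l.tail (l.headD false :: r)

theorem mr_nil (q : Q) (l : List Bool) : mr q l [] = mr q l [false] := by
  have : (Turing.ListBlank.mk [] : Turing.ListBlank Bool) = Turing.ListBlank.mk [false] :=
    Quotient.sound' (Or.inl ⟨1, rfl⟩)
  simp [mr, this]

theorem step_right {q q' : Q} {b b' : Bool} (h : table q b = some (b', Turing.Dir.right, q'))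
    (l r : List Bool) : step (mr q l (b :: r)) = some (mr q' (b' :: l) r) := by
  simp [step, mr, h, ← Turing.ListBlank.cons_mk]

theorem step_left {q q' : Q} {b b' : Bool} (h : table q b = some (b', Turing.Dir.left, q'))
    (l r : List Bool) : step (mr q l (b :: r)) = some (ml q' l (b' :: r)) := by
  cases l <;> simp [step, mr, ml, h, ← Turing.ListBlank.cons_mk]

theorem ml_left {q q' : Q} {b b' : Bool} (h : table q b = some (b', Turing.Dir.left, q'))
    (l r : List Bool) : step (ml q (b :: l) r) = some (ml q' l (b' :: r)) := step_left h l r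

/-! ### Sweeps over the blocks -/

/-- The block of `n` pairs `10`, read from right to left. -/
def lblk : ℕ → List Bool
  | 0 => []
  | n + 1 => false :: true :: lblk n

/-- The block of `n` pairs `10`, read from left to right. -/
def rblk : ℕ → List Bool
  | 0 => []
  | n + 1 => true :: false :: rblk n

theorem rblk_append_succ (n : ℕ) (r : List Bool) :
    rblk n ++ true :: false :: r = rblk (n + 1) ++ r := by
  induction n with
  | zero => rfl
  | succ n ih => simp only [rblk, List.cons_append, ih]

theorem lblk_append_succ (n : ℕ) (r : List Bool) :
    lblk n ++ false :: true :: r = lblk (n + 1) ++ r := by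
  induction n with
  | zero => rfl
  | succ n ih => simp only [lblk, List.cons_append, ih]

/-- The blocks `s`, each followed by the separator `1`, read from right to left. -/
def lword : List ℕ → List Bool
  | [] => []
  | a :: s => lblk a ++ true :: lword s

/-- The blocks `s`, each preceded by the separator `1`, read from left to right. -/
def rword : List ℕ → List Bool
  | [] => []
  | a :: s => rword s ++ true :: rblk a

/-- Two pairs take the machine through C, D, B, C back to C with the tape unchanged, so the state
behind a block records the parity of its length. -/
theorem reach_left_even (n : ℕ) (l r : List Bool) :
    Reach (ml .C (lblk (2 * n) ++ l) r) (ml .C l (rblk (2 * n) ++ r)) := by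
  induction n generalizing r with
  | zero => exact Reach.refl _
  | succ n ih =>
    have e : rblk (2 * (n + 1)) ++ r = rblk (2 * n) ++ true :: false :: true :: false :: r := by
      rw [rblk_append_succ, rblk_append_succ]; rfl
    rw [e]
    refine .head (ml_left rfl _ _) (.head (ml_left rfl _ _) (.head (ml_left rfl _ _)
      (.head (ml_left rfl _ _) (ih _))))

theorem reach_left_odd (n : ℕ) (l r : List Bool) :
    Reach (ml .C (lblk (2 * n + 1) ++ l) r) (ml .B l (rblk (2 * n + 1) ++ r)) := by
  have e : rblk (2 * n + 1) ++ r = true :: false :: (rblk (2 * n) ++ r) := rfl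
  have e' : lblk (2 * n + 1) ++ l = lblk (2 * n) ++ false :: true :: l :=
    (lblk_append_succ _ _).symm
  rw [e, e']
  exact (reach_left_even n _ r).trans (.head (ml_left rfl _ _) (.head (ml_left rfl _ _) (.refl _)))

theorem reach_left_word (s : List ℕ) (hs : ∀ a ∈ s, Even a) (l r : List Bool) :
    Reach (ml .C (lword s ++ l) r) (ml .C l (rword s ++ r)) := by
  induction s generalizing r with
  | nil => exact Reach.refl _
  | cons a s ih =>
    obtain ⟨n, hn⟩ := hs a (by simp)
    obtain rfl : a = 2 * n := by omega
    simp only [lword, rword, List.append_assoc, List.cons_append]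
    exact (reach_left_even n _ r).trans (.head (ml_left rfl _ _)
      (ih (fun b hb => hs b (by simp [hb])) _))

theorem reach_right_block (n : ℕ) (l r : List Bool) :
    Reach (mr .B l (rblk n ++ r)) (mr .B (lblk n ++ l) r) := by
  induction n generalizing l with
  | zero => exact Reach.refl _
  | succ n ih =>
    rw [← lblk_append_succ]
    exact .head (step_right rfl _ _) (.head (step_right rfl _ _) (ih _))

/-- A separator followed by a pair, `1 10`, is rewritten as `10 1`: one pair crosses the separator
to the left. -/
theorem reach_right_shift (n : ℕ) (l r : List Bool) :
    Reach (mr .B l (true :: rblk (n + 1) ++ r))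
      (mr .B (lblk n ++ true :: false :: true :: l) r) :=
  .head (step_right rfl _ _) (.head (step_right rfl _ _) (.head (step_right rfl _ _)
    (reach_right_block n _ _)))

/-- Every separator passed hands one pair to the left, so inner blocks break even and `c` gains one.
The block at the head, `d`, stays one short until the next separator is crossed. Positivity provides
the pair to hand over. -/
theorem reach_right_word (s : List ℕ) (hs : ∀ a ∈ s, 0 < a) (c : ℕ) (l r : List Bool) :
    ∃ (d : ℕ) (t : List Bool), Reach (mr .B (lblk c ++ l) (rword s ++ r)) (mr .B (lblk d ++ t) r) ∧
      lblk (d + 1) ++ t = lword s ++ (lblk (c + 1) ++ l) := by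
  induction s generalizing r with
  | nil => exact ⟨c, l, .refl _, rfl⟩
  | cons a s ih =>
    obtain ⟨d, t, h, e⟩ := ih (fun b hb => hs b (by simp [hb])) (true :: rblk a ++ r)
    obtain ⟨a, rfl⟩ := Nat.exists_eq_add_of_lt (hs a (by simp))
    rw [zero_add] at *
    refine ⟨a, true :: (lblk (d + 1) ++ t), ?_, ?_⟩
    · simp only [rword, List.append_assoc] at h ⊢
      exact h.trans (reach_right_shift a _ r)
    · simp [e, lword]

theorem reach_right_last (a : ℕ) (l : List Bool) :
    Reach (mr .B l (true :: rblk a))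
      (mr .B (if a = 0 then false :: true :: l else lblk (a - 1) ++ true :: false :: true :: l)
        []) := by
  rcases a with _ | a
  · refine .head (step_right rfl _ _) ?_
    rw [rblk, mr_nil]
    exact .head (step_right rfl _ _) (.refl _)
  · simpa using reach_right_shift a l []

/-- The left part of the tape that belongs to the blocks `a`, `s`, `c` and the rest `l`, where
`a` has been decreased and `c` has been increased; a block of length `-1` and its separator are
dropped. -/
theorem reach_right (a : ℕ) (s : List ℕ) (hs : ∀ b ∈ s, 0 < b) (c : ℕ) (l : List Bool) :
    Reach (mr .B (lblk c ++ l) (rword (a :: s)))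
      (mr .B ((if a = 0 then [] else lblk (a - 1) ++ [true]) ++ (lword s ++ (lblk (c + 1) ++ l)))
        []) := by
  obtain ⟨d, t, h, e⟩ := reach_right_word s hs c l (true :: rblk a)
  refine h.trans ?_
  rw [← e]
  convert reach_right_last a (lblk d ++ t) using 2
  split_ifs <;> simp [lblk]

/-! ### Full passes of the machine over the tape -/

theorem mr_append_false (q : Q) (l r : List Bool) : mr q l (r ++ [false]) = mr q l r := by
  have : (Turing.ListBlank.mk (r ++ [false]) : Turing.ListBlank Bool) = Turing.ListBlank.mk r :=
    Quotient.sound' (Or.inr ⟨1, rfl⟩)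
  simp [mr, this]

theorem ml_append_false (q : Q) (l r : List Bool) : ml q l (r ++ [false]) = ml q l r :=
  mr_append_false q l.tail (l.headD false :: r)

theorem rword_append (s t : List ℕ) : rword (s ++ t) = rword t ++ rword s := by
  induction s with
  | nil => simp [rword]
  | cons a s ih => simp [rword, ih]

theorem lword_append (s t : List ℕ) : lword (s ++ t) = lword s ++ lword t := by
  induction s with
  | nil => simp [lword]
  | cons a s ih => simp [lword, ih]

theorem reach_turn (l : List Bool) : Reach (mr .B l []) (ml .C l []) := by
  rw [mr_nil, ← ml_append_false]
  exact .head (step_left rfl _ _) (.refl _)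

/-- The left part of the tape after a pass in which the first block `a` is decreased, and is
dropped with its separator when it gets the length `-1`. -/
def decr (a : ℕ) : List Bool := if a = 0 then [] else lblk (a - 1) ++ [true]

theorem reach_increment {a b c : ℕ} {s p : List ℕ} (hp : a :: s = p ++ [b])
    (he : ∀ x ∈ p, Even x) (hb : Odd b) (hs : ∀ x ∈ s, 0 < x) (l : List Bool) :
    Reach (mr .B (lword (a :: s) ++ (lblk c ++ l)) [])
      (mr .B (decr a ++ (lword s ++ (lblk (c + 1) ++ l))) []) := by
  refine (reach_turn _).trans (Reach.trans ?_ (reach_right a s hs c l))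
  obtain ⟨n, rfl⟩ := hb
  rw [hp, lword_append, rword_append, List.append_assoc]
  refine (reach_left_word p he _ _).trans ?_
  have : Reach _ (mr .B (lblk c ++ l) (true :: _)) :=
    reach_left_odd n (true :: (lblk c ++ l)) (rword p)
  simpa [lword, rword] using this

theorem reach_zero {a c : ℕ} {s : List ℕ} (he : ∀ x ∈ a :: s, Even x) (hc : Even c)
    (hs : ∀ x ∈ s, 0 < x) :
    Reach (mr .B (lword (a :: s) ++ lblk c) [])
      (mr .B (decr a ++ (lword s ++ (lblk (c + 1) ++ [true, true]))) []) := by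
  refine (reach_turn _).trans (Reach.trans ?_ (reach_right a s hs c _))
  refine (reach_left_word _ he _ _).trans ?_
  obtain ⟨n, hn⟩ := hc
  obtain rfl : c = 2 * n := by omega
  have := reach_left_even n [] (rword (a :: s))
  rw [List.append_nil] at this ⊢
  refine this.trans (Reach.trans ?_ (reach_right_block (2 * n) _ _))
  exact .head (step_left rfl _ _) (.head (step_right rfl _ _) (.head (step_right rfl _ _)
    (.refl _)))

/-- Behind an odd `c` the blank end is met in state B instead of C, and the turn there writes at
once what Overflow and Zero append together, the entries `1, 0, 0`. No configuration for the state
in between is needed. -/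
theorem reach_overflow_zero {a c : ℕ} {s : List ℕ} (he : ∀ x ∈ a :: s, Even x) (hc : Odd c)
    (hs : ∀ x ∈ s, 0 < x) :
    Reach (mr .B (lword (a :: s) ++ lblk c) [])
      (mr .B (decr a ++ (lword s ++ (lblk (c + 1) ++ [true, false, true, true, true]))) []) := by
  refine (reach_turn _).trans (Reach.trans ?_ (reach_right a s hs c _))
  refine (reach_left_word _ he _ _).trans ?_
  obtain ⟨n, rfl⟩ := hc
  have := reach_left_odd n [] (rword (a :: s))
  rw [List.append_nil] at this ⊢
  refine this.trans (Reach.trans ?_ (reach_right_block (2 * n + 1) _ _))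
  refine .head (step_left rfl _ _) (.head (step_left rfl _ _) (.head (step_right rfl _ _)
    (.head (step_right rfl _ _) (.head (step_left rfl _ _) (.head (ml_left rfl _ _)
    (.head (ml_left rfl _ _) (.head (step_left rfl _ _) (.head (step_right rfl _ _)
    (.head (step_right rfl _ _) (.head (step_right rfl _ _) (.head (step_right rfl _ _)
    (.head (step_right rfl _ _) (.refl _)))))))))))))

/-! ### Configurations of the machine that represent states of the process -/

/-- The cells that represent a state, read from right to left. -/
def tapeWord : List ℤ → List Bool
  | [] => []
  | [a] => lblk a.toNat
  | a :: b :: s => lblk a.toNat ++ true :: tapeWord (b :: s)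

/-- The configuration that represents a state; a last entry `-1` is skipped. -/
def conf (S : State) : Cfg :=
  mr .B (tapeWord (if S.head? = some (-1) then S.tail else S)) []

theorem tapeWord_append (p : List ℤ) (c : ℤ) (t : List ℤ) :
    tapeWord (p ++ c :: t) = lword (p.map Int.toNat) ++ tapeWord (c :: t) := by
  induction p with
  | nil => rfl
  | cons a p ih =>
    rcases p with _ | ⟨b, p⟩
    · simp [tapeWord, lword]
    · simp only [List.cons_append] at ih
      simp [tapeWord, lword, ih]

theorem conf_cons {a : ℤ} (ha : a ≠ -1) (s : List ℤ) :
    conf (a :: s) = mr .B (tapeWord (a :: s)) [] := by simp [conf, ha]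

theorem conf_decr {a : ℤ} (ha : 0 ≤ a) (s : List ℤ) (c : ℤ) (t : List ℤ) :
    conf ((a - 1) :: (s ++ c :: t)) =
      mr .B (decr a.toNat ++ (lword (s.map Int.toNat) ++ tapeWord (c :: t))) [] := by
  rcases ha.eq_or_lt with rfl | ha
  · simp [conf, decr, tapeWord_append]
  · rw [conf_cons (by omega), ← List.cons_append, tapeWord_append]
    have h : a.toNat ≠ 0 := by omega
    have h' : (a - 1).toNat = a.toNat - 1 := by omega
    simp [decr, h, h', lword]

theorem exists_tapeWord_cons {c : ℤ} (hc : 0 ≤ c) (t : List ℤ) :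
    ∃ l, tapeWord (c :: t) = lblk c.toNat ++ l ∧
      tapeWord ((c + 1) :: t) = lblk (c.toNat + 1) ++ l := by
  have h : (c + 1).toNat = c.toNat + 1 := by omega
  cases t
  · exact ⟨[], by simp [tapeWord], by simp [tapeWord, h]⟩
  · exact ⟨_, rfl, by simp [tapeWord, h]⟩

theorem even_toNat {x : ℤ} (hx : 0 ≤ x) (h : Even x) : Even x.toNat := by
  obtain ⟨n, hn⟩ := h
  exact ⟨n.toNat, by omega⟩

theorem odd_toNat {x : ℤ} (hx : 0 ≤ x) (h : Odd x) : Odd x.toNat := by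
  obtain ⟨n, hn⟩ := h
  exact ⟨n.toNat, by omega⟩

theorem reach_conf_increment {a b c : ℤ} {s p : List ℤ} (hp : a :: s = p ++ [b])
    (he : ∀ x ∈ p, Even x) (hb : Odd b) (ha : 0 ≤ a) (hs : ∀ x ∈ s, 0 < x) (hc : 0 ≤ c)
    (t : List ℤ) :
    Reach (conf (a :: (s ++ c :: t))) (conf ((a - 1) :: (s ++ (c + 1) :: t))) := by
  have h0 : ∀ x ∈ p ++ [b], 0 ≤ x := by
    rw [← hp]; simp only [List.mem_cons, forall_eq_or_imp]
    exact ⟨ha, fun x hx => (hs x hx).le⟩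
  obtain ⟨l, h1, h2⟩ := exists_tapeWord_cons hc t
  rw [conf_decr ha, conf_cons (by omega), ← List.cons_append, tapeWord_append, h1, h2]
  refine reach_increment (p := p.map Int.toNat) (b := b.toNat) ?_ ?_ ?_ ?_ l
  · simpa using congrArg (List.map Int.toNat) hp
  · simp only [List.mem_map, forall_exists_index, and_imp, forall_apply_eq_imp_iff₂]
    exact fun x hx => even_toNat (h0 x (by simp [hx])) (he x hx)
  · exact odd_toNat (h0 b (by simp)) hb
  · simp only [List.mem_map, forall_exists_index, and_imp, forall_apply_eq_imp_iff₂]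
    intro x hx
    have := hs x hx
    omega

theorem reach_conf_zero {a c : ℤ} {s : List ℤ} (ha : 0 ≤ a) (hs : ∀ x ∈ s, 0 < x) (hc : 0 ≤ c)
    (he : ∀ x ∈ a :: s, Even x) (hce : Even c) :
    Reach (conf (a :: (s ++ [c]))) (conf ((a - 1) :: (s ++ [c + 1, 0, 0]))) := by
  rw [conf_decr ha, conf_cons (by omega), ← List.cons_append, tapeWord_append]
  have h : (c + 1).toNat = c.toNat + 1 := by omega
  have := reach_zero (a := a.toNat) (s := s.map Int.toNat) (c := c.toNat) ?_ (even_toNat hc hce) ?_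
  · simpa [tapeWord, h, lblk] using this
  · rw [← List.map_cons]
    simp only [List.mem_map, forall_exists_index, and_imp, forall_apply_eq_imp_iff₂]
    refine fun x hx => even_toNat ?_ (he x hx)
    rcases List.mem_cons.1 hx with rfl | hx
    exacts [ha, (hs x hx).le]
  · simp only [List.mem_map, forall_exists_index, and_imp, forall_apply_eq_imp_iff₂]
    intro x hx
    have := hs x hx
    omega

theorem reach_conf_overflow_zero {a c : ℤ} {s : List ℤ} (ha : 0 ≤ a) (hs : ∀ x ∈ s, 0 < x)
    (hc : 0 ≤ c) (he : ∀ x ∈ a :: s, Even x) (hco : Odd c) :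
    Reach (conf (a :: (s ++ [c]))) (conf ((a - 1) :: (s ++ [c + 1, 1, 0, 0]))) := by
  rw [conf_decr ha, conf_cons (by omega), ← List.cons_append, tapeWord_append]
  have h : (c + 1).toNat = c.toNat + 1 := by omega
  have := reach_overflow_zero (a := a.toNat) (s := s.map Int.toNat) (c := c.toNat) ?_
    (odd_toNat hc hco) ?_
  · simpa [tapeWord, h, lblk] using this
  · rw [← List.map_cons]
    simp only [List.mem_map, forall_exists_index, and_imp, forall_apply_eq_imp_iff₂]
    refine fun x hx => even_toNat ?_ (he x hx)
    rcases List.mem_cons.1 hx with rfl | hx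
    exacts [ha, (hs x hx).le]
  · simp only [List.mem_map, forall_exists_index, and_imp, forall_apply_eq_imp_iff₂]
    intro x hx
    have := hs x hx
    omega

-- The target represents the result of Zero on `S_1`; the number of moves comes from running the
-- machine.
set_option maxRecDepth 100000 in
theorem reach_initial : Reach initial (conf [-1, 4, 2, 1, 0, 0]) := by
  refine ⟨239, ?_⟩
  have h : initial = mr .A [] [] := rfl
  rw [h]
  have : iter step 239 (mr .A [] []) = some (mr .B (tapeWord [4, 2, 1, 0, 0]) [false]) := by
    rfl
  rw [this, ← mr_nil]
  rfl

/-! ### Counting the integers with a given power of two -/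

/-- For `i ≥ 1` and `x ≥ 0`, the number of integers in `[1, x]` that are divisible by `2^(i-1)`
but not by `2^i`. -/
def carry : ℕ → ℤ → ℤ
  | 0, _ => 0
  | i + 1, x => (x + 2 ^ i) / 2 ^ (i + 1)

theorem carry_succ_add_mul (i : ℕ) (x m : ℤ) :
    carry (i + 1) (x + 2 ^ (i + 1) * m) = carry (i + 1) x + m := by
  have h : (2 : ℤ) ^ (i + 1) ≠ 0 := by positivity
  simp only [carry]
  rw [show x + 2 ^ (i + 1) * m + 2 ^ i = x + 2 ^ i + 2 ^ (i + 1) * m by ring,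
    Int.add_mul_ediv_left _ _ h]

theorem carry_add_pow {i n : ℕ} (hi : 1 ≤ i) (h : i ≤ n) (x : ℤ) :
    carry i (x + 2 ^ n) = carry i x + 2 ^ (n - i) := by
  obtain ⟨i, rfl⟩ := Nat.exists_eq_add_of_le' hi
  rw [← carry_succ_add_mul, ← pow_add]
  congr 3
  omega

theorem carry_sub_pow {i n : ℕ} (hi : 1 ≤ i) (h : i ≤ n) (x : ℤ) :
    carry i (x - 2 ^ n) = carry i x - 2 ^ (n - i) := by
  have := carry_add_pow hi h (x - 2 ^ n)
  rw [sub_add_cancel] at this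
  omega

theorem carry_two_mul (i : ℕ) (x : ℤ) : carry (i + 2) (2 * x) = carry (i + 1) x := by
  simp only [carry]
  rw [show 2 * x + 2 ^ (i + 1) = 2 * (x + 2 ^ i) by ring,
    show (2 : ℤ) ^ (i + 1 + 1) = 2 * 2 ^ (i + 1) by ring,
    Int.mul_ediv_mul_of_pos _ _ (by norm_num)]

theorem carry_one_two_mul (x : ℤ) : carry 1 (2 * x) = x := by
  simp only [carry]
  omega

/-- For `i ≥ 1`, `carry i x` is the integer nearest to `(x + 1/2) / 2 ^ i`, and ties do not occur;
the reflection negates `x + 1/2`. -/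
theorem carry_neg (i : ℕ) (x : ℤ) : carry i (-1 - x) = -carry i x := by
  cases i with
  | zero => rfl
  | succ i =>
    simp only [carry]
    have hp : (0 : ℤ) < 2 ^ (i + 1) := by positivity
    have e : (2 : ℤ) ^ (i + 1) = 2 * 2 ^ i := by ring
    have h1 := Int.emod_nonneg (x + 2 ^ i) hp.ne'
    have h2 := Int.emod_lt_of_pos (x + 2 ^ i) hp
    have h3 := Int.mul_ediv_add_emod (x + 2 ^ i) (2 ^ (i + 1))
    generalize (x + 2 ^ i) / 2 ^ (i + 1) = q at *
    rw [Int.ediv_eq_iff_of_pos hp]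
    generalize (2 : ℤ) ^ (i + 1) = p at *
    constructor <;> nlinarith

theorem carry_eq_zero {i : ℕ} {x : ℤ} (h : -2 ^ i ≤ x) (h' : x < 2 ^ i) : carry (i + 1) x = 0 := by
  simp only [carry]
  exact Int.ediv_eq_zero_of_lt (by linarith) (by rw [pow_succ]; linarith)

theorem carry_zero (i : ℕ) : carry i 0 = 0 := by
  cases i with
  | zero => rfl
  | succ i =>
    have : (0 : ℤ) < 2 ^ i := by positivity
    exact carry_eq_zero (by linarith) this

theorem carry_neg_one (i : ℕ) : carry i (-1) = 0 := by
  simpa [carry_zero] using carry_neg i 0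

theorem carry_pow_mul_odd {i s : ℕ} {y u : ℤ} (hy : y = 2 ^ s * (2 * u + 1)) :
    carry i y = carry i (y - 1) + if i = s + 1 then 1 else 0 := by
  cases i with
  | zero => simp [carry]
  | succ i =>
    rcases lt_trichotomy i s with h | rfl | h
    · obtain ⟨r, rfl⟩ := Nat.exists_eq_add_of_le h
      have h1 := carry_succ_add_mul i 0 (2 ^ r * (2 * u + 1))
      have h2 := carry_succ_add_mul i (-1) (2 ^ r * (2 * u + 1))
      rw [carry_zero] at h1
      rw [carry_neg_one] at h2
      have e : y = 2 ^ (i + 1) * (2 ^ r * (2 * u + 1)) := by rw [hy, Nat.succ_eq_add_one, pow_add]; ring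
      rw [if_neg (by omega), e, ← zero_add (2 ^ (i + 1) * _), h1,
        show (0 : ℤ) + 2 ^ (i + 1) * (2 ^ r * (2 * u + 1)) - 1
          = -1 + 2 ^ (i + 1) * (2 ^ r * (2 * u + 1)) by ring, h2]
      ring
    · have h1 := carry_succ_add_mul i (2 ^ i) u
      have h2 := carry_succ_add_mul i (2 ^ i - 1) u
      have hp : (0 : ℤ) < 2 ^ i := by positivity
      rw [carry_eq_zero (x := 2 ^ i - 1) (by linarith) (by linarith)] at h2
      have h3 : carry (i + 1) (2 ^ i) = 1 := by
        simp only [carry]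
        rw [show (2 : ℤ) ^ i + 2 ^ i = 2 ^ (i + 1) by ring]
        exact Int.ediv_self (by positivity)
      rw [if_pos rfl, show y = 2 ^ i + 2 ^ (i + 1) * u by rw [hy]; ring, h1,
        show (2 : ℤ) ^ i + 2 ^ (i + 1) * u - 1 = 2 ^ i - 1 + 2 ^ (i + 1) * u by ring, h2, h3]
      ring
    · rw [if_neg (by omega), add_zero]
      simp only [carry]
      have hp : (0 : ℤ) < 2 ^ (i + 1) := by positivity
      have h1 := Int.emod_nonneg (y + 2 ^ i) hp.ne'
      have h2 := Int.emod_lt_of_pos (y + 2 ^ i) hp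
      have h3 := Int.mul_ediv_add_emod (y + 2 ^ i) (2 ^ (i + 1))
      have h4 : (y + 2 ^ i) % 2 ^ (i + 1) ≠ 0 := by
        intro h0
        obtain ⟨r, rfl⟩ := Nat.exists_eq_add_of_lt h
        obtain ⟨q, hq⟩ := Int.dvd_of_emod_eq_zero h0
        have hs : (2 : ℤ) ^ s ≠ 0 := by positivity
        have : (2 : ℤ) ^ s * (2 * u + 1 + 2 ^ (r + 1)) = 2 ^ s * (2 ^ (r + 2) * q) := by
          rw [hy] at hq
          rw [show s + r + 1 + 1 = s + (r + 2) by ring, show s + r + 1 = s + (r + 1) by ring] at hq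
          rw [pow_add 2 s (r + 2), pow_add 2 s (r + 1)] at hq
          linarith
        have := mul_left_cancel₀ hs this
        rw [pow_succ, pow_succ (n := r + 1), pow_succ] at this
        generalize (2 : ℤ) ^ r = w at this
        have e : w * 2 * 2 * q = 2 * (2 * (w * q)) := by ring
        have e' : w * 2 = 2 * w := by ring
        omega
      symm
      rw [Int.ediv_eq_iff_of_pos hp]
      generalize (y + 2 ^ i) / 2 ^ (i + 1) = q at *
      generalize (y + 2 ^ i) % 2 ^ (i + 1) = t at *
      have : 1 ≤ t := by omega
      constructor <;> nlinarith

theorem exists_pow_mul_odd {y : ℤ} (hy : y ≠ 0) : ∃ (s : ℕ) (u : ℤ), y = 2 ^ s * (2 * u + 1) := by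
  obtain ⟨n, m, h1, h2⟩ := Nat.exists_eq_two_pow_mul_odd (Int.natAbs_ne_zero.2 hy)
  obtain ⟨u, rfl⟩ := h1
  rcases Int.natAbs_eq y with h | h
  · exact ⟨n, u, by rw [h, h2]; push_cast; ring⟩
  · exact ⟨n, -u - 1, by rw [h, h2]; push_cast; ring⟩

theorem exists_pow_mul_odd_of_not_dvd {L : ℕ} {y : ℤ} (hy : ¬ (2 : ℤ) ^ L ∣ y) :
    ∃ (s : ℕ) (u : ℤ), s < L ∧ y = 2 ^ s * (2 * u + 1) := by
  have h0 : y ≠ 0 := by rintro rfl; simp at hy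
  obtain ⟨s, u, h⟩ := exists_pow_mul_odd h0
  refine ⟨s, u, ?_, h⟩
  by_contra hs
  exact hy (h ▸ Dvd.dvd.mul_right (pow_dvd_pow 2 (not_lt.1 hs)) _)

/-! ### Runs of the process -/

/-- The process gets from `S` to `T` and applies the rule Overflow exactly `c` times. -/
def Run (c : ℕ) (S T : State) : Prop :=
  ∃ m, iter P m S = some T ∧ (rulesApplied m S).count Rule.overflow = c

theorem rulesApplied_add {m : ℕ} {S T : State} (h : iter P m S = some T) (n : ℕ) :
    rulesApplied (m + n) S = rulesApplied m S ++ rulesApplied n T := by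
  induction m generalizing S with
  | zero =>
    obtain rfl : S = T := by simpa [iter] using h
    simp [rulesApplied]
  | succ m ih =>
    rw [Nat.succ_add]
    simp only [iter] at h
    cases hP : P S with
    | none => simp [hP] at h
    | some S' =>
      rw [hP] at h
      simp [rulesApplied, hP, ih h]

theorem Run.refl (S : State) : Run 0 S S := ⟨0, rfl, rfl⟩

theorem Run.trans {c d : ℕ} {S T U : State} (h : Run c S T) (h' : Run d T U) :
    Run (c + d) S U := by
  obtain ⟨m, hm, hc⟩ := h
  obtain ⟨n, hn, hd⟩ := h'
  refine ⟨m + n, ?_, ?_⟩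
  · rw [iter_add, hm]; exact hn
  · rw [rulesApplied_add hm, List.count_append, hc, hd]

theorem Run.single {S T : State} {r : Rule} (h : rule S = some r) (h' : applyRule r S = some T) :
    Run (if r = .overflow then 1 else 0) S T := by
  have hP : P S = some T := by simp [P, h, h']
  refine ⟨1, by simp [iter, hP], ?_⟩
  cases r <;> simp [rulesApplied, h, hP]

/-- A run of the process that the machine simulates. -/
def Path (c : ℕ) (S T : State) : Prop := Run c S T ∧ Reach (conf S) (conf T)

theorem Path.refl (S : State) : Path 0 S S := ⟨.refl S, .refl _⟩

theorem Path.trans {c d : ℕ} {S T U : State} (h : Path c S T) (h' : Path d T U) :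
    Path (c + d) S U := ⟨h.1.trans h'.1, h.2.trans h'.2⟩

/-! ### States given by functions -/

/-- The state with the entries `a 0, …, a L`. -/
def st (L : ℕ) (a : ℕ → ℤ) : State := (List.range (L + 1)).map a

theorem st_congr {L : ℕ} {a b : ℕ → ℤ} (h : ∀ i ≤ L, a i = b i) : st L a = st L b :=
  List.map_congr_left fun i hi => h i (by have := List.mem_range.1 hi; omega)

theorem length_st (L : ℕ) (a : ℕ → ℤ) : (st L a).length = L + 1 := by simp [st]

theorem top_st (L : ℕ) (a : ℕ → ℤ) : top (st L a) = L := by simp [top, st]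

theorem entry_st {L i : ℕ} (h : i ≤ L) (a : ℕ → ℤ) : entry (st L a) i = a i := by
  have : i < L + 1 := by omega
  simp [entry, st, this]

theorem modify_st (L i : ℕ) (a : ℕ → ℤ) (f : ℤ → ℤ) :
    (st L a).modify i f = st L fun j => if j = i then f (a j) else a j := by
  apply List.ext_getElem
  · simp [st]
  · intro j h1 h2
    simp [st, List.getElem_modify, eq_comm]

theorem st_append (L : ℕ) (a : ℕ → ℤ) (c : ℤ) :
    st L a ++ [c] = st (L + 1) fun i => if i ≤ L then a i else c := by
  have : st L a = st L fun i => if i ≤ L then a i else c := st_congr fun i hi => by simp [hi]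
  rw [this]
  simp [st, List.range_succ (n := L + 1)]

theorem st_succ (L : ℕ) (a : ℕ → ℤ) : st (L + 1) a = a 0 :: st L fun i => a (i + 1) := by
  simp [st, List.range_succ_eq_map (n := L + 1), Function.comp_def]

theorem st_split (i r : ℕ) (a : ℕ → ℤ) :
    st (i + 1 + r) a = st i a ++ st r fun j => a (i + 1 + j) := by
  simp [st, add_assoc, List.range_add, Function.comp_def]

theorem findIdx_st {L i : ℕ} {a : ℕ → ℤ} (hi : i ≤ L) (h : Odd (a i)) (h' : ∀ j < i, Even (a j)) :
    (st L a).findIdx (fun a => decide (Odd a)) = i := by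
  rw [List.findIdx_eq (by rw [length_st]; omega)]
  constructor
  · simpa [st] using h
  · intro j hj
    simpa [st] using h' j hj

theorem rule_st (L : ℕ) (a : ℕ → ℤ) (hL : 1 ≤ L) : rule (st L a) =
    if Odd (a L) ∧ ∀ i < L, Even (a i) then some .overflow
    else if ∀ i ≤ L, Even (a i) then
      if a L = 0 ∧ a (L - 1) = 0 then some .halt else some .zero
    else if a 0 = -1 then some .halve else some .increment := by
  have h1 : (∀ i < L, Even (entry (st L a) i)) ↔ ∀ i < L, Even (a i) :=
    forall₂_congr fun i hi => by rw [entry_st hi.le]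
  have h2 : (∀ i ≤ L, Even (entry (st L a) i)) ↔ ∀ i ≤ L, Even (a i) :=
    forall₂_congr fun i hi => by rw [entry_st hi]
  simp only [rule, length_st, top_st, h1, h2, entry_st le_rfl, entry_st (Nat.zero_le L),
    entry_st (Nat.sub_le L 1)]
  rw [if_neg (by omega)]

/-! ### Single rules, for the process and the machine -/

/-- The entries are at least `-1`, `0`, and `1` at the index `0`, at the top two indices, and at
the other indices. -/
structure Good (L : ℕ) (a : ℕ → ℤ) : Prop where
  zero : -1 ≤ a 0
  pos : ∀ i, 1 ≤ i → i + 2 ≤ L → 1 ≤ a i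
  nonneg : ∀ i, 1 ≤ i → i ≤ L → 0 ≤ a i

theorem path_increment {L s : ℕ} {a : ℕ → ℤ} (hg : Good L a) (h0 : a 0 ≠ -1) (hs : s < L)
    (hodd : Odd (a s)) (heven : ∀ j < s, Even (a j)) :
    Path 0 (st L a)
      (st L fun j => a j + (if j = s + 1 then 1 else 0) - (if j = 0 then 1 else 0)) := by
  constructor
  · refine Run.single (r := .increment) ?_ ?_
    · rw [rule_st L a (by omega), if_neg, if_neg, if_neg h0]
      · exact fun h => Int.not_even_iff_odd.2 hodd (h s hs.le)
      · exact fun h => Int.not_even_iff_odd.2 hodd (h.2 s hs)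
    · simp only [applyRule, findIdx_st hs.le hodd heven, modify_st]
      congr 1
      refine st_congr fun i _ => ?_
      rcases i with _ | i <;> simp
      split_ifs <;> simp
  · obtain ⟨r, rfl⟩ := Nat.exists_eq_add_of_lt hs
    have hz : 0 ≤ a 0 := by have := hg.zero; omega
    have e : ∀ b : ℕ → ℤ, st (s + r + 1) b =
        b 0 :: (((List.range s).map fun i => b (i + 1)) ++
          b (s + 1) :: (List.range r).map fun i => b (s + 2 + i)) := by
      intro b
      rw [show s + r + 1 = s + 1 + r by ring, st_split]
      simp [st, List.range_succ_eq_map, Function.comp_def]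
      exact fun i _ => congrArg b (by omega)
    rw [e, e]
    have := reach_conf_increment (a := a 0) (b := a s) (c := a (s + 1))
      (s := (List.range s).map fun i => a (i + 1)) (p := (List.range s).map a)
      ?_ ?_ hodd hz ?_ ?_ ((List.range r).map fun i => a (s + 2 + i))
    · convert this using 2
      simp only [if_true]
      congr 1
      · simp
      · congr 1
        · refine List.map_congr_left fun i hi => ?_
          have := List.mem_range.1 hi
          rw [if_neg (by omega), if_neg (by omega)]; ring
        · congr 1
          · rw [if_neg (by omega)]; ring
          · refine List.map_congr_left fun i hi => ?_
            rw [if_neg (by omega), if_neg (by omega)]; ring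
    · have h : (List.range (s + 1)).map a = (List.range (s + 1)).map a := rfl
      conv_lhs at h => rw [List.range_succ_eq_map]
      rw [List.range_succ] at h
      simpa [Function.comp_def] using h
    · simpa using heven
    · simp only [List.mem_map, List.mem_range, forall_exists_index, and_imp,
        forall_apply_eq_imp_iff₂]
      intro i hi
      have := hg.nonneg (i + 1) (by omega) (by omega)
      rcases Nat.lt_or_ge (i + 1) s with h | h
      · exact hg.pos (i + 1) (by omega) (by omega)
      -- For `s = L - 1`, `Good` gives only nonnegativity; the odd parity excludes zero.
      · obtain rfl : i + 1 = s := by omega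
        obtain ⟨w, hw⟩ := hodd
        omega
    · exact hg.nonneg _ (by omega) (by omega)

/-- The representing configuration already skips the entry `-1`, so Halve costs the machine no move.
-/
theorem path_halve {L : ℕ} {a : ℕ → ℤ} (hg : Good (L + 1) a) (h0 : a 0 = -1) :
    Path 0 (st (L + 1) a) (st L fun i => a (i + 1)) := by
  have hodd : ¬ Even (a 0) := by rw [h0]; decide
  constructor
  · refine Run.single (r := .halve) ?_ ?_
    · rw [rule_st _ _ (by omega), if_neg, if_neg, if_pos h0]
      · exact fun h => hodd (h 0 (by omega))
      · exact fun h => hodd (h.2 0 (by omega))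
    · simp [applyRule, st_succ]
  · have h1 : a 1 ≠ -1 := by have := hg.nonneg 1 le_rfl (by omega); omega
    rw [st_succ, h0]
    have e : conf (st L fun i => a (i + 1)) = mr .B (tapeWord (st L fun i => a (i + 1))) [] := by
      cases L with
      | zero => exact conf_cons h1 _
      | succ L => rw [st_succ, conf_cons h1]
    rw [e]
    exact .refl _

/-- The effect of the rule Zero. -/
def zeroed (L : ℕ) (a : ℕ → ℤ) (i : ℕ) : ℤ :=
  if i = 0 then a 0 - 1 else if i < L then a i else if i = L then a L + 1 else 0

theorem run_zero {L : ℕ} {a : ℕ → ℤ} (hL : 1 ≤ L) (he : ∀ i ≤ L, Even (a i))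
    (hne : ¬ (a L = 0 ∧ a (L - 1) = 0)) : Run 0 (st L a) (st (L + 2) (zeroed L a)) := by
  refine Run.single (r := .zero) ?_ ?_
  · rw [rule_st _ _ hL, if_neg, if_pos he, if_neg hne]
    exact fun h => Int.not_even_iff_odd.2 h.1 (he L le_rfl)
  · simp only [applyRule, top_st, modify_st]
    rw [show ([0, 0] : List ℤ) = [0] ++ [0] from rfl, ← List.append_assoc, st_append, st_append]
    congr 1
    refine st_congr fun i hi => ?_
    simp only [zeroed]
    split_ifs <;> first | rfl | omega | (subst_vars; rfl)

theorem st_eq_cons_append_singleton (L : ℕ) (a : ℕ → ℤ) :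
    st (L + 1) a = a 0 :: (((List.range L).map fun i => a (i + 1)) ++ [a (L + 1)]) := by
  rw [st_succ, st, List.range_succ]
  simp

theorem path_zero {L : ℕ} {a : ℕ → ℤ} (hL : 2 ≤ L) (he : ∀ i ≤ L, Even (a i)) (h0 : 0 ≤ a 0)
    (htop : 0 ≤ a L) (hpos : ∀ i, 1 ≤ i → i < L → 1 ≤ a i) :
    Path 0 (st L a) (st (L + 2) (zeroed L a)) := by
  constructor
  · refine run_zero (by omega) he fun h => ?_
    have := hpos (L - 1) (by omega) (by omega)
    omega
  · obtain ⟨L, rfl⟩ := Nat.exists_eq_add_of_le' (show 1 ≤ L by omega)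
    have := reach_conf_zero (a := a 0) (c := a (L + 1))
      (s := (List.range L).map fun i => a (i + 1)) h0 ?_ htop ?_ (he _ le_rfl)
    · rw [st_eq_cons_append_singleton]
      convert this using 2
      rw [st_eq_cons_append_singleton, List.range_succ, List.range_succ]
      simp [zeroed]
      exact fun i h h' => absurd h' (by omega)
    · simp only [List.mem_map, List.mem_range, forall_exists_index, and_imp,
        forall_apply_eq_imp_iff₂]
      exact fun i hi => hpos _ (by omega) (by omega)
    · simp only [List.mem_cons, List.mem_map, List.mem_range, forall_eq_or_imp,
        forall_exists_index, and_imp, forall_apply_eq_imp_iff₂]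
      exact ⟨he 0 (by omega), fun i hi => he _ (by omega)⟩

/-- The effect of the rule Overflow. -/
def overflowed (L : ℕ) (a : ℕ → ℤ) (i : ℕ) : ℤ :=
  if i < L then a i else if i = L then a L + 1 else 0

theorem path_overflow_zero {L : ℕ} {a : ℕ → ℤ} (hL : 2 ≤ L) (he : ∀ i < L, Even (a i))
    (hodd : Odd (a L)) (h0 : 0 ≤ a 0) (htop : 0 ≤ a L) (hpos : ∀ i, 1 ≤ i → i < L → 1 ≤ a i) :
    Path 1 (st L a) (st (L + 3) (zeroed (L + 1) (overflowed L a))) := by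
  constructor
  · have h1 : Run 1 (st L a) (st (L + 1) (overflowed L a)) := by
      refine Run.single (r := .overflow) ?_ ?_
      · rw [rule_st _ _ (by omega), if_pos ⟨hodd, he⟩]
      · simp only [applyRule, top_st, modify_st]
        rw [st_append]
        congr 1
        refine st_congr fun i hi => ?_
        simp only [overflowed]
        split_ifs <;> first | rfl | omega | (subst_vars; rfl)
    refine h1.trans (run_zero (by omega) ?_ ?_)
    · intro i hi
      simp only [overflowed]
      split_ifs with h h'
      · exact he i h
      · exact hodd.add_odd odd_one
      · exact Even.zero
    · simp [overflowed]
      omega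
  · obtain ⟨L, rfl⟩ := Nat.exists_eq_add_of_le' (show 1 ≤ L by omega)
    have := reach_conf_overflow_zero (a := a 0) (c := a (L + 1))
      (s := (List.range L).map fun i => a (i + 1)) h0 ?_ htop ?_ hodd
    · rw [st_eq_cons_append_singleton]
      convert this using 2
      rw [st_eq_cons_append_singleton, List.range_succ, List.range_succ, List.range_succ]
      simp [zeroed, overflowed]
      exact fun i h => by rw [if_pos (by omega), if_pos h]
    · simp only [List.mem_map, List.mem_range, forall_exists_index, and_imp,
        forall_apply_eq_imp_iff₂]
      exact fun i hi => hpos _ (by omega) (by omega)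
    · simp only [List.mem_cons, List.mem_map, List.mem_range, forall_eq_or_imp,
        forall_exists_index, and_imp, forall_apply_eq_imp_iff₂]
      exact ⟨he 0 (by omega), fun i hi => he _ (by omega)⟩

/-! ### Increments as steps of the Gray code -/

/-- The parities of the entries at the indices `1, …, L` form the Gray code of `N` if `N ≥ 0` and
of `-1 - N` otherwise, and the sum of all entries is odd or even accordingly. -/
def Coherent (L : ℕ) (N : ℤ) (a : ℕ → ℤ) : Prop :=
  Odd (a 0 - N) ∧ ∀ i, 1 ≤ i → i ≤ L → Even (a i - carry i N)

/-- The effect of `d` applications of the rule Increment to a state that is coherent at `N`. -/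
def advance (N : ℤ) (d : ℕ) (a : ℕ → ℤ) (i : ℕ) : ℤ :=
  a i + carry i (N + d) - carry i N - if i = 0 then (d : ℤ) else 0

theorem Coherent.advance {L : ℕ} {N : ℤ} {a : ℕ → ℤ} (h : Coherent L N a) (d : ℕ) :
    Coherent L (N + d) (advance N d a) := by
  obtain ⟨h1, h2⟩ := h
  constructor
  · obtain ⟨k, hk⟩ := h1
    exact ⟨k - d, by simp [Skelet17.advance, carry]; omega⟩
  · intro i hi hi'
    obtain ⟨k, hk⟩ := h2 i hi hi'
    refine ⟨k, ?_⟩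
    simp only [Skelet17.advance, if_neg (show i ≠ 0 by omega)]
    omega

/-- If `N + 1` is `2 ^ s` times an odd number, `carry j N` is even for `1 ≤ j < s` and odd for `j =
s ≥ 1`, so the least odd entry is at `s`. The bound `s < L` excludes Overflow and Zero. -/
theorem path_advance_one {L : ℕ} {N : ℤ} {a : ℕ → ℤ} (hc : Coherent L N a) (hg : Good L a)
    (h0 : 0 ≤ a 0) (hN : ¬ (2 : ℤ) ^ L ∣ N + 1) : Path 0 (st L a) (st L (advance N 1 a)) := by
  obtain ⟨s, u, hs, hu⟩ := exists_pow_mul_odd_of_not_dvd hN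
  have key : ∀ j, 1 ≤ j → j ≤ s → carry j N = 2 ^ (s - j) * (2 * u + 1) := by
    intro j hj hjs
    obtain ⟨j, rfl⟩ := Nat.exists_eq_add_of_le' hj
    have := carry_succ_add_mul j (-1) (2 ^ (s - (j + 1)) * (2 * u + 1))
    rw [carry_neg_one, zero_add, ← mul_assoc, ← pow_add, show j + 1 + (s - (j + 1)) = s by omega,
      ← hu] at this
    rw [← this]
    congr 1
    ring
  have hodd : Odd (a s) := by
    rcases Nat.eq_zero_or_pos s with rfl | hpos
    · have h1 : Odd (N + 1) := by rw [hu]; exact ⟨u, by ring⟩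
      have := hc.1
      rw [Int.odd_iff] at *
      omega
    · have h1 := key s hpos le_rfl
      have h2 := hc.2 s hpos hs.le
      rw [h1, Nat.sub_self, pow_zero] at h2
      rw [Int.even_iff] at h2
      rw [Int.odd_iff]
      omega
  have heven : ∀ j < s, Even (a j) := by
    intro j hj
    rcases Nat.eq_zero_or_pos j with rfl | hpos
    · have h1 : Even (N + 1) := by
        rw [hu]
        exact (Even.pow_of_ne_zero even_two (by omega)).mul_right _
      have := hc.1
      rw [Int.odd_iff] at this
      rw [Int.even_iff] at *
      omega
    · have h1 := key j hpos hj.le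
      have h2 := hc.2 j hpos (by omega)
      have h3 : Even (carry j N) := by
        rw [h1]
        exact (Even.pow_of_ne_zero even_two (by omega)).mul_right _
      simpa using h2.add h3
  convert path_increment hg (by omega) hs hodd heven using 2
  funext i
  have := carry_pow_mul_odd (i := i) hu
  rw [add_sub_cancel_right] at this
  simp only [advance, Nat.cast_one, this]
  ring

theorem Good.advance_one {L : ℕ} {N : ℤ} {a : ℕ → ℤ} (hg : Good L a) (h0 : 0 ≤ a 0) :
    Good L (advance N 1 a) := by
  have mono : ∀ i, 1 ≤ i → a i ≤ advance N 1 a i := by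
    intro i hi
    obtain ⟨i, rfl⟩ := Nat.exists_eq_add_of_le' hi
    have h : carry (i + 1) N ≤ carry (i + 1) (N + 1) :=
      Int.ediv_le_ediv (by positivity) (by omega)
    simp [advance]
    omega
  refine ⟨?_, fun i hi hi' => (hg.pos i hi hi').trans (mono i hi),
    fun i hi hi' => (hg.nonneg i hi hi').trans (mono i hi)⟩
  simp [advance, carry]
  omega

theorem path_advance {L : ℕ} {N : ℤ} {a : ℕ → ℤ} (hc : Coherent L N a) (hg : Good L a)
    (d : ℕ) (hd : d ≤ a 0 + 1) (hN : ∀ j : ℕ, 1 ≤ j → j ≤ d → ¬ (2 : ℤ) ^ L ∣ N + j) :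
    Path 0 (st L a) (st L (advance N d a)) ∧ Good L (advance N d a) := by
  induction d with
  | zero =>
    have : advance N 0 a = a := by funext i; simp [advance]
    rw [this]
    exact ⟨.refl _, hg⟩
  | succ d ih =>
    push_cast at hd
    obtain ⟨h1, h2⟩ := ih (by omega) fun j hj hj' => hN j hj (by omega)
    have h0 : 0 ≤ advance N d a 0 := by
      simp [advance, carry]
      omega
    have e : advance N (d + 1) a = advance (N + d) 1 (advance N d a) := by
      funext i
      simp only [advance]
      push_cast
      rw [add_assoc N]
      split_ifs <;> ring
    rw [e]
    have h3 := hN (d + 1) (by omega) le_rfl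
    push_cast at h3
    rw [← add_assoc] at h3
    exact ⟨h1.trans (path_advance_one (hc.advance d) h2 h0 h3), h2.advance_one h0⟩

/-- Dropping the lowest digit leaves the Gray code of `N`, but the new entry `0` has the parity of
`N` instead of the opposite one. The reflection `-1 - N` keeps the code and corrects this; the code
is then traversed backwards. -/
theorem Coherent.tail {L : ℕ} {N : ℤ} {a : ℕ → ℤ} (h : Coherent (L + 1) (2 * N) a) :
    Coherent L (-1 - N) fun i => a (i + 1) := by
  constructor
  · obtain ⟨k, hk⟩ := h.2 1 le_rfl (by omega)
    rw [carry_one_two_mul] at hk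
    exact ⟨k + N, by simp; omega⟩
  · intro i hi hi'
    obtain ⟨i, rfl⟩ := Nat.exists_eq_add_of_le' hi
    obtain ⟨k, hk⟩ := h.2 (i + 2) (by omega) (by omega)
    rw [carry_two_mul] at hk
    rw [carry_neg]
    exact ⟨k + carry (i + 1) N, by simp only [add_assoc, Nat.reduceAdd]; omega⟩

theorem not_dvd_of_pos {p y : ℤ} (h : 0 < y) (h' : y < p) : ¬ p ∣ y := fun hd =>
  absurd (Int.le_of_dvd h hd) (by omega)

theorem not_dvd_of_neg {p y : ℤ} (h : y < 0) (h' : -p < y) : ¬ p ∣ y := fun hd =>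
  absurd (Int.le_of_dvd (by omega) ((dvd_neg (a := p)).2 hd)) (by omega)

theorem carry_eq_zero_of_lt {i n : ℕ} {x : ℤ} (hi : n < i) (h : -2 ^ n ≤ x) (h' : x < 2 ^ n) :
    carry i x = 0 := by
  obtain ⟨r, rfl⟩ := Nat.exists_eq_add_of_lt hi
  have : (2 : ℤ) ^ n ≤ 2 ^ (n + r) := pow_le_pow_right₀ (by norm_num) (by omega)
  exact carry_eq_zero (by linarith) (by linarith)

theorem carry_neg_pow {i n : ℕ} (hi : 1 ≤ i) (h : i ≤ n) : carry i (-2 ^ n) = -2 ^ (n - i) := by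
  simpa [carry_zero] using carry_sub_pow hi h 0

theorem carry_neg_pow_of_lt {i n : ℕ} (h : n < i) : carry i (-2 ^ n) = 0 := by
  have : (0 : ℤ) < 2 ^ n := by positivity
  exact carry_eq_zero_of_lt h le_rfl (by linarith)

theorem even_two_pow {n : ℕ} (hn : 1 ≤ n) : Even ((2 : ℤ) ^ n) :=
  even_two.pow_of_ne_zero (by omega)

theorem coherent_zeroed {L : ℕ} (hL : 1 ≤ L) {e : ℕ → ℤ} (he : ∀ i ≤ L, Even (e i)) :
    Coherent (L + 2) (-2 ^ L) (zeroed L e) := by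
  constructor
  · obtain ⟨k, hk⟩ := he 0 (by omega)
    obtain ⟨m, hm⟩ := even_two_pow hL
    exact ⟨k + m - 1, by simp [zeroed]; omega⟩
  · intro i hi hi'
    rcases lt_trichotomy i L with h | rfl | h
    · rw [carry_neg_pow hi h.le, zeroed, if_neg (by omega), if_pos h, sub_neg_eq_add]
      exact (he i h.le).add (even_two_pow (by omega))
    · obtain ⟨k, hk⟩ := he i le_rfl
      rw [carry_neg_pow hi le_rfl, zeroed, if_neg (by omega), if_neg (by omega), if_pos rfl]
      exact ⟨k + 1, by simp; omega⟩
    · rw [carry_neg_pow_of_lt h, zeroed, if_neg (by omega), if_neg (by omega), if_neg (by omega)]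
      simp

theorem good_zeroed {L : ℕ} {e : ℕ → ℤ} (h0 : 0 ≤ e 0) (htop : 0 ≤ e L)
    (hpos : ∀ i, 1 ≤ i → i < L → 1 ≤ e i) : Good (L + 2) (zeroed L e) := by
  have pos : ∀ i, 1 ≤ i → i ≤ L → 1 ≤ zeroed L e i := by
    intro i hi hi'
    rw [zeroed, if_neg (by omega)]
    split_ifs with h h'
    · exact hpos i hi h
    · omega
    · omega
  refine ⟨by simp [zeroed]; omega, fun i hi hi' => pos i hi (by omega), fun i hi _ => ?_⟩
  rcases Nat.lt_or_ge L i with h | h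
  · rw [zeroed, if_neg (by omega), if_neg (by omega), if_neg (by omega)]
  · exact zero_le_one.trans (pos i hi h)

theorem Good.tail {L : ℕ} {a : ℕ → ℤ} (h : Good (L + 1) a) : Good L fun i => a (i + 1) := by
  refine ⟨?_, fun i hi hi' => h.pos _ (by omega) (by omega),
    fun i hi hi' => h.nonneg _ (by omega) (by omega)⟩
  have := h.nonneg 1 le_rfl (by omega)
  simp only [zero_add]
  omega

/-! ### The course of a round -/

/-- The state after the first Halve of a round. -/
def firstHalf (l : ℕ) (e : ℕ → ℤ) (x : ℤ) (i : ℕ) : ℤ :=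
  zeroed (l + 1) e (i + 1) + carry (i + 1) (2 * (x - 2 ^ l)) - carry (i + 1) (-2 ^ (l + 1))

/-- Entry `0` starts at `2 * x - 1`, so Halve is due after `2 * x` increments, at the still negative
position `2 * (x - 2 ^ l)`. -/
theorem path_firstHalf {l : ℕ} {e : ℕ → ℤ} {x : ℤ} (he : ∀ i ≤ l + 1, Even (e i))
    (hx : e 0 = 2 * x) (hx0 : 0 ≤ x) (hx1 : x < 2 ^ l) (htop : 0 ≤ e (l + 1))
    (hpos : ∀ i, 1 ≤ i → i < l + 1 → 1 ≤ e i) :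
    Path 0 (st (l + 3) (zeroed (l + 1) e)) (st (l + 2) (firstHalf l e x)) ∧
      Good (l + 2) (firstHalf l e x) ∧ Coherent (l + 2) (-1 - (x - 2 ^ l)) (firstHalf l e x) := by
  have hc := coherent_zeroed (show 1 ≤ l + 1 by omega) he
  have hg := good_zeroed (by omega) htop hpos
  have hd : ((2 * x).toNat : ℤ) = 2 * x := by omega
  have hN : -2 ^ (l + 1) + 2 * x = 2 * (x - 2 ^ l) := by ring
  have hp : (2 : ℤ) ^ (l + 1 + 2) = 8 * 2 ^ l := by ring
  have hp' : (2 : ℤ) ^ (l + 1) = 2 * 2 ^ l := by ring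
  obtain ⟨h1, h2⟩ := path_advance hc hg (2 * x).toNat (by simp [zeroed]; omega) (fun j hj hj' =>
    not_dvd_of_neg (by omega) (by omega))
  have h3 := hc.advance (2 * x).toNat
  have e0 : advance (-2 ^ (l + 1)) (2 * x).toNat (zeroed (l + 1) e) 0 = -1 := by
    simp [advance, zeroed, carry]
    omega
  have e1 : (fun i => advance (-2 ^ (l + 1)) (2 * x).toNat (zeroed (l + 1) e) (i + 1))
      = firstHalf l e x := by
    funext i
    simp only [advance, hd, hN, firstHalf, Nat.succ_ne_zero, if_false]
    ring
  rw [hd, hN] at h3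
  have h4 := path_halve h2 e0
  have h5 := h2.tail
  have h6 := h3.tail
  rw [e1] at h4 h5 h6
  exact ⟨h1.trans h4, h5, h6⟩

/-- The state after the second Halve of a round. -/
def secondHalf (l : ℕ) (e : ℕ → ℤ) (x y : ℤ) (i : ℕ) : ℤ :=
  firstHalf l e x (i + 1) + carry (i + 1) (2 * (2 ^ l + y)) + carry (i + 1) (x - 2 ^ l)

theorem firstHalf_zero {l : ℕ} (hl : 1 ≤ l) {e : ℕ → ℤ} {x y : ℤ} (hy : e 1 = 2 ^ l + 2 * y) :
    firstHalf l e x 0 = 2 ^ l + 2 * y + x := by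
  rw [firstHalf, zero_add, carry_one_two_mul, show -(2 : ℤ) ^ (l + 1) = 2 * (-2 ^ l) by ring,
    carry_one_two_mul, zeroed, if_neg (by omega), if_pos (by omega), hy]
  ring

/-- Entry `0` now starts at `2 ^ l + 2 * y + x` and reaches `-1` at position `2 * (2 ^ l + y)`. The
bound on `y` keeps this below `2 ^ (l + 2)`, before which Overflow would intervene. -/
theorem path_secondHalf {l : ℕ} (hl : 1 ≤ l) {e : ℕ → ℤ} {x y : ℤ}
    (hy : e 1 = 2 ^ l + 2 * y) (hx0 : 0 ≤ x) (hx1 : x < 2 ^ l)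
    (hy0 : -2 ^ l ≤ 2 * y) (hy1 : y < 2 ^ l)
    (hg : Good (l + 2) (firstHalf l e x))
    (hc : Coherent (l + 2) (-1 - (x - 2 ^ l)) (firstHalf l e x)) :
    Path 0 (st (l + 2) (firstHalf l e x)) (st (l + 1) (secondHalf l e x y)) ∧
      Good (l + 1) (secondHalf l e x y) ∧
      Coherent (l + 1) (-1 - (2 ^ l + y)) (secondHalf l e x y) := by
  have hd : ((2 ^ l + 2 * y + x + 1).toNat : ℤ) = 2 ^ l + 2 * y + x + 1 :=
    Int.toNat_of_nonneg (by omega)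
  have hN : -1 - (x - 2 ^ l) + (2 ^ l + 2 * y + x + 1) = 2 * (2 ^ l + y) := by ring
  have hp : (2 : ℤ) ^ (l + 2) = 4 * 2 ^ l := by ring
  have hz := firstHalf_zero hl (x := x) hy
  obtain ⟨h1, h2⟩ := path_advance hc hg (2 ^ l + 2 * y + x + 1).toNat (by omega) (fun j hj hj' =>
    not_dvd_of_pos (by omega) (by omega))
  have h3 := hc.advance (2 ^ l + 2 * y + x + 1).toNat
  have e0 : advance (-1 - (x - 2 ^ l)) (2 ^ l + 2 * y + x + 1).toNat (firstHalf l e x) 0 = -1 := by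
    simp only [advance, carry, if_true]
    omega
  have e1 : (fun i => advance (-1 - (x - 2 ^ l)) (2 ^ l + 2 * y + x + 1).toNat (firstHalf l e x)
      (i + 1)) = secondHalf l e x y := by
    funext i
    simp only [advance, hd, hN, secondHalf, Nat.succ_ne_zero, if_false, carry_neg]
    ring
  rw [hd, hN] at h3
  have h4 := path_halve h2 e0
  have h5 := h2.tail
  have h6 := h3.tail
  rw [e1] at h4 h5 h6
  exact ⟨h1.trans h4, h5, h6⟩

/-- The state at the end of a round. -/
def round (l : ℕ) (e : ℕ → ℤ) (x y : ℤ) (i : ℕ) : ℤ :=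
  zeroed (l + 1) e (i + 2) + 2 * carry (i + 1) (x - 2 ^ l) + 2 * carry i (2 ^ l + y)
    - carry (i + 2) (-2 ^ (l + 1))

theorem round_eq (l : ℕ) (e : ℕ → ℤ) (x y : ℤ) (i : ℕ) :
    round l e x y i = secondHalf l e x y i + carry i (2 ^ l + y)
      - if i = 0 then 2 ^ l + y else 0 := by
  rw [round, secondHalf, firstHalf, carry_two_mul]
  rcases i with _ | i
  · rw [carry_one_two_mul]
    simp [carry]
    ring
  · rw [carry_two_mul, if_neg (by omega)]
    ring

/-- A further `2 ^ l + y` increments end at position `-1`, where all entries are even; `hr` ensures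
that entry `0` does not run out first. -/
theorem path_round {l : ℕ} (hl : 1 ≤ l) {e : ℕ → ℤ} {x y : ℤ} (he : ∀ i ≤ l + 1, Even (e i))
    (hx : e 0 = 2 * x) (hy : e 1 = 2 ^ l + 2 * y) (hx0 : 0 ≤ x) (hx1 : x < 2 ^ l)
    (hy0 : -2 ^ l ≤ 2 * y) (hy1 : y < 2 ^ l) (htop : 0 ≤ e (l + 1))
    (hpos : ∀ i, 1 ≤ i → i < l + 1 → 1 ≤ e i) (hr : 0 ≤ round l e x y 0) :
    Path 0 (st (l + 3) (zeroed (l + 1) e)) (st (l + 1) (round l e x y)) := by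
  obtain ⟨h1, g1, c1⟩ := path_firstHalf he hx hx0 hx1 htop hpos
  obtain ⟨h2, g2, c2⟩ := path_secondHalf hl hy hx0 hx1 hy0 hy1 g1 c1
  have hd : ((2 ^ l + y).toNat : ℤ) = 2 ^ l + y := Int.toNat_of_nonneg (by omega)
  rw [round_eq, if_pos rfl] at hr
  simp only [carry] at hr
  have hp : (2 : ℤ) ^ (l + 1) = 2 * 2 ^ l := by ring
  obtain ⟨h3, -⟩ := path_advance c2 g2 (2 ^ l + y).toNat (by omega) (fun j hj hj' =>
    not_dvd_of_neg (by omega) (by omega))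
  have e1 : advance (-1 - (2 ^ l + y)) (2 ^ l + y).toNat (secondHalf l e x y) = round l e x y := by
    funext i
    rw [round_eq, advance, hd, sub_add_cancel, carry_neg_one, carry_neg]
    ring
  rw [e1] at h3
  exact (h1.trans h2).trans h3

/-- The state after the rules of a round up to Overflow, without the effect of Overflow. -/
def preOverflow (l : ℕ) (e : ℕ → ℤ) (x : ℤ) (i : ℕ) : ℤ :=
  if i = 0 then 0 else
  zeroed (l + 1) e (i + 1) + 2 * carry (i + 1) (2 * (x - 2 ^ l)) - carry (i + 1) (-2 ^ (l + 1))
    + carry i (2 ^ (l + 2) - 1)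

theorem carry_pow_sub_one {i n : ℕ} (hi : 1 ≤ i) (h : i ≤ n) :
    carry i (2 ^ n - 1) = 2 ^ (n - i) := by
  have := carry_add_pow hi h (-1)
  rwa [carry_neg_one, zero_add, neg_add_eq_sub] at this

/-- This is the boundary case `y = 2 ^ l`: position `2 ^ (l + 2) - 1` comes before the second Halve,
with entry `0` down to `0` and only the top entry odd. -/
theorem path_preOverflow {l : ℕ} (hl : 1 ≤ l) {e : ℕ → ℤ} {x : ℤ}
    (he : ∀ i ≤ l + 1, Even (e i))
    (hx : e 0 = 2 * x) (hy : e 1 = 2 ^ l + 2 * 2 ^ l) (hx0 : 0 ≤ x) (hx1 : x < 2 ^ l)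
    (htop : 0 ≤ e (l + 1)) (hpos : ∀ i, 1 ≤ i → i < l + 1 → 1 ≤ e i) :
    Path 1 (st (l + 3) (zeroed (l + 1) e))
      (st (l + 5) (zeroed (l + 3) (overflowed (l + 2) (preOverflow l e x)))) := by
  obtain ⟨h1, g1, c1⟩ := path_firstHalf he hx hx0 hx1 htop hpos
  have hd : ((3 * 2 ^ l + x).toNat : ℤ) = 3 * 2 ^ l + x := Int.toNat_of_nonneg (by omega)
  have hN : -1 - (x - 2 ^ l) + (3 * 2 ^ l + x) = 2 ^ (l + 2) - 1 := by ring
  have hp : (2 : ℤ) ^ (l + 2) = 4 * 2 ^ l := by ring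
  have hz := firstHalf_zero hl (x := x) hy
  obtain ⟨h2, g2⟩ := path_advance c1 g1 (3 * 2 ^ l + x).toNat (by omega) (fun j hj hj' =>
    not_dvd_of_pos (by omega) (by omega))
  have c2 := c1.advance (3 * 2 ^ l + x).toNat
  have e1 : advance (-1 - (x - 2 ^ l)) (3 * 2 ^ l + x).toNat (firstHalf l e x)
      = preOverflow l e x := by
    funext i
    rw [advance, hd, hN, carry_neg, preOverflow]
    split_ifs with hi
    · subst hi
      rw [hz]
      simp only [carry]
      ring
    · obtain ⟨i, rfl⟩ := Nat.exists_eq_succ_of_ne_zero hi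
      rw [firstHalf, Nat.succ_eq_add_one, add_assoc i 1 1, carry_two_mul]
      ring
  rw [hd, hN, e1] at c2
  rw [e1] at h2 g2
  refine (h1.trans h2).trans (path_overflow_zero (by omega) ?_ ?_ ?_ ?_ ?_)
  · intro i hi
    rcases Nat.eq_zero_or_pos i with rfl | hi'
    · simp [preOverflow]
    · have h := c2.2 i hi' hi.le
      rw [carry_pow_sub_one hi' hi.le] at h
      simpa using h.add (even_two_pow (show 1 ≤ l + 2 - i by omega))
  · have h := c2.2 (l + 2) (by omega) le_rfl
    rw [carry_pow_sub_one (by omega) le_rfl] at h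
    simpa using h.add_odd odd_one
  · simp [preOverflow]
  · exact g2.nonneg _ (by omega) le_rfl
  · intro i hi hi'
    rcases Nat.lt_or_ge i (l + 1) with h | h
    · exact g2.pos i hi (by omega)
    · obtain rfl : i = l + 1 := by omega
      have h2 : carry (l + 1 + 1) (2 * (x - 2 ^ l)) = 0 :=
        carry_eq_zero_of_lt (n := l + 1) (by omega) (by rw [pow_succ]; linarith)
          (by rw [pow_succ]; linarith)
      rw [preOverflow, if_neg (by omega), h2, carry_neg_pow_of_lt (by omega),
        carry_pow_sub_one (by omega) (by omega), zeroed, if_neg (by omega), if_neg (by omega),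
        if_neg (by omega)]
      have : (0 : ℤ) < 2 ^ (l + 2 - (l + 1)) := by positivity
      omega

/-! ### States near a multiple of the powers of two -/

/-- The entries of the states `S_k`, for `L = 2 * k + 1`. -/
def base (L i : ℕ) : ℤ := if 1 ≤ i ∧ i < L then 2 ^ (L - i) else 0

/-- The entries of a state with even entries that differs from `base L` by `2 * D`. -/
def full (L : ℕ) (D : ℕ → ℤ) (i : ℕ) : ℤ := base L i + 2 * D i

/-- The effect of a round on the differences `D`. -/
def next (L : ℕ) (D : ℕ → ℤ) (i : ℕ) : ℤ :=
  D (i + 2) + carry (i + 1) (D 0) + carry i (D 1) + if i = L ∧ 0 ≤ D 1 then 1 else 0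

theorem even_full (L : ℕ) (D : ℕ → ℤ) (i : ℕ) : Even (full L D i) := by
  refine Even.add ?_ (even_two_mul _)
  rw [base]
  split_ifs with h
  · exact even_two_pow (by omega)
  · exact Even.zero

theorem full_zero (L : ℕ) (D : ℕ → ℤ) : full L D 0 = 2 * D 0 := by simp [full, base]

/-- For `1 ≤ i < l` and `r = l - 1 - i` the powers of two add up to `2 ^ r - 2 * 2 ^ r + 2 * 2 ^ (r
+ 1) + 2 ^ r = 2 ^ (r + 2)`, which restores `base`. The extra term of `next` at the top records
whether `2 ^ l + D 1` reaches `2 ^ l`. -/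
theorem round_full {l : ℕ} (hl : 2 ≤ l) {D : ℕ → ℤ} (hs : ∀ i > l + 1, D i = 0)
    (hx0 : 0 ≤ D 0) (hx1 : D 0 < 2 ^ l) (hy0 : -2 ^ l ≤ D 1) (hy1 : D 1 < 2 ^ l)
    {i : ℕ} (hi : i ≤ l + 1) :
    round l (full (l + 1) D) (D 0) (D 1) i = full (l + 1) (next (l + 1) D) i := by
  have hp : (0 : ℤ) < 2 ^ l := by positivity
  rw [round, full, next]
  rcases Nat.lt_or_ge i l with h | h
  · obtain ⟨r, rfl⟩ := Nat.exists_eq_add_of_lt h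
    rw [carry_sub_pow (by omega) (by omega), carry_neg_pow (by omega) (by omega)]
    have e1 : i + r + 1 - (i + 1) = r := by omega
    have e2 : i + r + 1 + 1 - (i + 2) = r := by omega
    have e3 : i + r + 1 + 1 - i = r + 2 := by omega
    have e4 : i + r + 1 - i = r + 1 := by omega
    have hz : zeroed (i + r + 1 + 1) (full (i + r + 1 + 1) D) (i + 2) = 2 ^ r + 2 * D (i + 2) := by
      rw [zeroed, if_neg (by omega)]
      rcases Nat.eq_zero_or_pos r with rfl | hr
      · rw [if_neg (by omega), if_pos (by omega), full, base, if_neg (by omega)]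
        simp only [add_zero, add_assoc, Nat.reduceAdd]
        ring
      · rw [if_pos (by omega), full, base, if_pos (by omega), e2]
    rw [hz, e1, e2, if_neg (by omega)]
    rcases Nat.eq_zero_or_pos i with rfl | hi'
    · simp only [base, carry]
      rw [if_neg (by omega)]
      ring
    · rw [add_comm (2 ^ (i + r + 1)) (D 1), carry_add_pow hi' (by omega), base,
        if_pos (by omega), e3, e4]
      ring
  · have hz : zeroed (l + 1) (full (l + 1) D) (i + 2) = 0 := by
      rw [zeroed, if_neg (by omega), if_neg (by omega), if_neg (by omega)]
    rw [hz, hs (i + 2) (by omega), carry_neg_pow_of_lt (by omega),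
      carry_eq_zero_of_lt (i := i + 1) (n := l) (by omega) (by linarith) (by linarith),
      carry_eq_zero_of_lt (i := i + 1) (n := l) (x := D 0) (by omega) (by linarith) (by linarith)]
    rcases h.eq_or_lt with rfl | h
    · rw [add_comm (2 ^ l) (D 1), carry_add_pow (by omega) le_rfl, Nat.sub_self, pow_zero, base,
        if_pos (by omega), if_neg (by omega), show l + 1 - l = 1 by omega]
      ring
    · obtain rfl : i = l + 1 := by omega
      rw [carry_eq_zero_of_lt (i := l + 1) (n := l) (x := D 1) (by omega) hy0 hy1, base,
        if_neg (by omega)]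
      have : carry (l + 1) (2 ^ l + D 1) = if 0 ≤ D 1 then 1 else 0 := by
        have hq : (2 : ℤ) ^ (l + 1) = 2 * 2 ^ l := by ring
        rw [carry, Int.ediv_eq_iff_of_pos (by positivity)]
        split_ifs <;> constructor <;> omega
      rw [this]
      simp

/-- Add one to the value at `f`. -/
def bump (D : ℕ → ℤ) (f i : ℕ) : ℤ := D i + if i = f then 1 else 0

/-- A round adds one to the value of `D` at `f`. -/
structure Inv (L : ℕ) (D : ℕ → ℤ) (f : ℕ) : Prop where
  next_eq : ∀ i ≤ L, next L D i = bump D f i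
  le : f ≤ L
  supp : ∀ i > L, D i = 0

theorem Inv.bump_supp {L f : ℕ} {D : ℕ → ℤ} (h : Inv L D f) : ∀ i > L, bump D f i = 0 := by
  intro i hi
  have := h.le
  rw [bump, h.supp i hi, if_neg (by omega)]
  rfl

/-- `D 0` and `D 1` are unchanged, and the term `D (i + 2)` of `next` moves the added one down two
places. -/
theorem Inv.bump_add_two {L f : ℕ} {D : ℕ → ℤ} (h : Inv L D (f + 2)) :
    Inv L (bump D (f + 2)) f := by
  refine ⟨fun i hi => ?_, by have := h.le; omega, h.bump_supp⟩
  have h1 := h.next_eq i hi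
  rw [bump, ← h1]
  simp [next, bump]
  ring

theorem Inv.bump_zero {L : ℕ} {D : ℕ → ℤ} (h : Inv L D 0) {s : ℕ} {u : ℤ}
    (hu : D 0 + 1 = 2 ^ s * (2 * u + 1)) (hs : s ≤ L) : Inv L (bump D 0) s := by
  refine ⟨fun i hi => ?_, hs, h.bump_supp⟩
  have h1 := h.next_eq i hi
  have h2 := carry_pow_mul_odd (i := i + 1) hu
  rw [add_sub_cancel_right] at h2
  rw [bump, ← h1]
  simp [next, bump, h2]
  ring

/-- Only `carry (s + 1) (D 1)` changes. The sign term of `next` does not, since `D 1 + 1` is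
nonzero. -/
theorem Inv.bump_one {L : ℕ} {D : ℕ → ℤ} (h : Inv L D 1) {s : ℕ} {u : ℤ}
    (hu : D 1 + 1 = 2 ^ s * (2 * u + 1)) (hs : s + 1 ≤ L) : Inv L (bump D 1) (s + 1) := by
  refine ⟨fun i hi => ?_, hs, h.bump_supp⟩
  have h1 := h.next_eq i hi
  have h2 := carry_pow_mul_odd (i := i) hu
  rw [add_sub_cancel_right] at h2
  have h3 : D 1 + 1 ≠ 0 := by
    rw [hu]
    have : (2 : ℤ) ^ s ≠ 0 := by positivity
    exact mul_ne_zero this (by omega)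
  have h4 : 0 ≤ D 1 + 1 ↔ 0 ≤ D 1 := by omega
  rw [bump, ← h1]
  simp [next, bump, h2, h4]
  ring

/-- The carries vanish at both `-1` and `0`, so the change of sign alone counts, and it acts at the
top index. -/
theorem Inv.bump_one_top {L : ℕ} {D : ℕ → ℤ} (h : Inv L D 1) (hD : D 1 = -1) :
    Inv L (bump D 1) L := by
  refine ⟨fun i hi => ?_, le_rfl, h.bump_supp⟩
  have h1 := h.next_eq i hi
  rw [bump, ← h1]
  simp [next, bump, hD, carry_zero, carry_neg_one]

theorem inv_zero (L : ℕ) : Inv L 0 L := by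
  refine ⟨fun i _ => ?_, le_rfl, fun _ _ => rfl⟩
  simp [next, bump, carry_zero]

theorem Inv.path_zeroed {l f : ℕ} {D : ℕ → ℤ} (h : Inv (l + 1) D f) (hl : 2 ≤ l)
    (hx0 : 0 ≤ D 0) (hx1 : D 0 < 2 ^ l) (hy0 : -2 ^ l ≤ 2 * D 1) (hy1 : D 1 < 2 ^ l)
    (htop : 0 ≤ D (l + 1)) (hpos : ∀ i, 1 ≤ i → i < l + 1 → 1 ≤ full (l + 1) D i) :
    Path 0 (st (l + 3) (zeroed (l + 1) (full (l + 1) D)))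
      (st (l + 1) (full (l + 1) (bump D f))) := by
  have hp : (0 : ℤ) < 2 ^ l := by positivity
  have key : ∀ i ≤ l + 1, round l (full (l + 1) D) (D 0) (D 1) i
      = full (l + 1) (bump D f) i := by
    intro i hi
    rw [round_full hl h.supp hx0 hx1 (by linarith) hy1 hi, full, full, h.next_eq i hi]
  rw [← st_congr key]
  refine path_round (by omega) (fun i _ => even_full _ _ i) (full_zero _ _) ?_ hx0 hx1 hy0 hy1 ?_
    hpos ?_
  · rw [full, base, if_pos (by omega), Nat.add_sub_cancel]
  · rw [full, base, if_neg (by omega)]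
    omega
  · rw [key 0 (by omega), full_zero, bump]
    split_ifs <;> omega

theorem path_zero_full {l : ℕ} {D : ℕ → ℤ} (hl : 2 ≤ l) (hx0 : 0 ≤ D 0) (htop : 0 ≤ D (l + 1))
    (hpos : ∀ i, 1 ≤ i → i < l + 1 → 1 ≤ full (l + 1) D i) :
    Path 0 (st (l + 1) (full (l + 1) D)) (st (l + 3) (zeroed (l + 1) (full (l + 1) D))) := by
  refine path_zero (by omega) (fun i _ => even_full _ _ i) ?_ ?_ hpos
  · rw [full_zero]
    omega
  · rw [full, base, if_neg (by omega)]
    omega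

theorem one_le_full {L : ℕ} {D : ℕ → ℤ} (h : ∀ i, 0 ≤ D i) (i : ℕ) (hi : 1 ≤ i) (hi' : i < L) :
    1 ≤ full L D i := by
  have : (0 : ℤ) < 2 ^ (L - i) := by positivity
  have := h i
  rw [full, base, if_pos ⟨hi, hi'⟩]
  omega

/-! ### Integers whose power of two has an odd exponent -/

theorem pow_mul_odd_unique {s t : ℕ} {u v : ℤ}
    (h : (2 : ℤ) ^ s * (2 * u + 1) = 2 ^ t * (2 * v + 1)) : s = t := by
  have h1 := carry_pow_mul_odd (i := s + 1) (s := s) (u := u) rfl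
  have h2 := carry_pow_mul_odd (i := s + 1) (s := t) (u := v) h
  rw [if_pos rfl] at h1
  by_contra hst
  rw [if_neg (by omega)] at h2
  omega

open Classical in
/-- The number of positive integers up to `n` that are divisible by exactly an odd power of `2`. -/
noncomputable def ev (n : ℕ) : ℕ :=
  Nat.count (fun m => ∃ (s : ℕ) (u : ℤ), Odd s ∧ (m : ℤ) + 1 = 2 ^ s * (2 * u + 1)) n

theorem ev_mono : Monotone ev := by
  classical
  exact fun _ _ h => Nat.count_monotone _ h

theorem ev_succ {n s : ℕ} {u : ℤ} (hu : (n : ℤ) + 1 = 2 ^ s * (2 * u + 1)) :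
    ev (n + 1) = ev n + if Odd s then 1 else 0 := by
  classical
  rw [ev, ev, Nat.count_succ]
  congr 2
  rw [eq_iff_iff]
  constructor
  · rintro ⟨t, v, ht, hv⟩
    rwa [pow_mul_odd_unique (hu.symm.trans hv)]
  · exact fun h => ⟨s, u, h, hu⟩

/-- Of the last three numbers up to `4 ^ (k + 1)` only `4 ^ (k + 1) - 2`, twice an odd number, is
counted; the power itself has an even exponent. -/
theorem ev_four_pow {k n : ℕ} (hn : n + 3 = 2 ^ (2 * (k + 1))) :
    ev (n + 3) = ev n + 1 ∧ ev (n + 2) = ev n + 1 ∧ ev (n + 1) = ev n + 1 := by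
  have hn' : (n : ℤ) + 3 = 2 ^ (2 * (k + 1)) := by exact_mod_cast hn
  have h4 : (2 : ℤ) ^ (2 * (k + 1)) = 4 * 2 ^ (2 * k) := by ring
  have h1 : ev (n + 1) = ev n + 1 :=
    ev_succ (s := 1) (u := 2 ^ (2 * k) - 1) (by rw [pow_one]; linarith)
  have h2 : ev (n + 2) = ev (n + 1) + 0 :=
    ev_succ (s := 0) (u := 2 * 2 ^ (2 * k) - 1) (by push_cast; linarith)
  have h3 : ev (n + 3) = ev (n + 2) + if Odd (2 * (k + 1)) then 1 else 0 :=
    ev_succ (u := 0) (by push_cast; linarith)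
  rw [if_neg (by simp)] at h3
  omega

theorem lt_of_pow_mul_odd_le {s n : ℕ} {u y : ℤ} (h : y = 2 ^ s * (2 * u + 1)) (h0 : 0 < y)
    (hy : y < 2 ^ n) : s < n := by
  have hs : (2 : ℤ) ^ s ≤ y := Int.le_of_dvd h0 ⟨_, h⟩
  exact (pow_lt_pow_iff_right₀ (by norm_num : (1 : ℤ) < 2)).1 (hs.trans_lt hy)

/-! ### The rounds before Overflow -/

/-- The differences `D` at the start of the round in which Overflow is applied. -/
def IsLast (l : ℕ) (D : ℕ → ℤ) : Prop :=
  D 0 = 2 ^ l - 2 ∧ ∀ i, 1 ≤ i → i ≤ l + 1 → D i = 2 ^ (l + 1 - i) - if Even i then 1 else 0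

/-- Below the top, `Inv` says that `next` fixes `D`, which expresses `D i` by `D (i + 2)`, `D 0` and
`D 1`: a recursion downwards from the top. -/
theorem Inv.isLast {l : ℕ} {D : ℕ → ℤ} (h : Inv (l + 1) D (l + 1)) (hl : Even l) (hl2 : 2 ≤ l)
    (hx : D 0 = 2 ^ l - 2) (hy : D 1 = 2 ^ l) : IsLast l D := by
  refine ⟨hx, ?_⟩
  have hp : (4 : ℤ) ≤ 2 ^ l := by
    calc (4 : ℤ) = 2 ^ 2 := by norm_num
      _ ≤ 2 ^ l := pow_le_pow_right₀ (by norm_num) hl2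
  have hb : ∀ i, 1 ≤ i → i ≤ l → carry i (2 ^ l) = 2 ^ (l - i) := by
    intro i hi hi'
    simpa [carry_zero] using carry_add_pow hi hi' 0
  have key : ∀ j i, i + j = l + 1 → 1 ≤ i → D i = 2 ^ j - if Even i then 1 else 0 := by
    intro j
    induction j using Nat.strong_induction_on with
    | _ j ih =>
      intro i hij hi
      have h1 := h.next_eq i (by omega)
      rw [next, bump, hx, hy] at h1
      rcases j with _ | _ | j
      · obtain rfl : i = l + 1 := by omega
        have h2 : carry (l + 1) (2 ^ l) = 1 := by
          simp only [carry]
          rw [show (2 : ℤ) ^ l + 2 ^ l = 2 ^ (l + 1) by ring]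
          exact Int.ediv_self (by positivity)
        rw [h.supp _ (by omega), carry_eq_zero_of_lt (n := l) (by omega) (by omega) (by omega), h2,
          if_pos ⟨rfl, by omega⟩, if_pos rfl] at h1
        rw [if_neg (by simpa [Nat.even_add_one] using hl)]
        simp only [pow_zero]
        omega
      · obtain rfl : i = l := by omega
        rw [h.supp _ (by omega), carry_eq_zero_of_lt (n := i) (by omega) (by omega) (by omega),
          hb i hi le_rfl, Nat.sub_self, if_neg (by omega), if_neg (by omega)] at h1
        rw [if_pos hl]
        omega
      · have h2 := ih j (by omega) (i + 2) (by omega) (by omega)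
        have h3 : carry (i + 1) (2 ^ l - 2) = 2 ^ j := by
          have := carry_add_pow (i := i + 1) (n := l) (by omega) (by omega) (-2)
          rw [carry_eq_zero_of_lt (x := -2) (n := 1) (by omega) (by norm_num) (by norm_num),
            zero_add, show l - (i + 1) = j by omega] at this
          rw [← this]
          congr 1
        rw [if_neg (by omega), if_neg (by omega), h2, h3, hb i hi (by omega),
          show l - i = j + 1 by omega] at h1
        have he : Even (i + 2) ↔ Even i := by simp [Nat.even_add]
        simp only [he] at h1
        rw [← add_zero (D i), ← h1]
        ring
  intro i hi hi'
  exact key _ i (by omega) hi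

theorem bump_nonneg {D : ℕ → ℤ} (h : ∀ i, 0 ≤ D i) (f i : ℕ) : 0 ≤ bump D f i := by
  have := h i
  rw [bump]
  split_ifs <;> omega

/-- The index `f` turns from odd to even when `D 1` takes a value with odd exponent, and back when
`D 0` does. These switches alternate, which is the invariant `hev`. -/
theorem exists_path_isLast (k : ℕ) {D : ℕ → ℤ} {f : ℕ} (h : Inv (2 * (k + 1) + 1) D f)
    (h0 : ∀ i, 0 ≤ D i) (hx : D 0 + 2 ≤ 2 ^ (2 * (k + 1))) (hy : D 1 < 2 ^ (2 * (k + 1)))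
    (hev : ev (D 1).toNat = ev (D 0).toNat + if Even f then 1 else 0) :
    ∃ D', Path 0 (st (2 * (k + 1) + 1) (full (2 * (k + 1) + 1) D))
      (st (2 * (k + 1) + 1) (full (2 * (k + 1) + 1) D')) ∧ (∀ i, 0 ≤ D' i) ∧
      IsLast (2 * (k + 1)) D' := by
  -- A lexicographic measure: the room left for `D 0 + D 1`, then `f`, which is less than `2 * k +
  -- 4`.
  obtain ⟨N, hN⟩ : ∃ N : ℕ, N = (2 * 2 ^ (2 * (k + 1)) - D 0 - D 1).toNat * (2 * k + 4) + f :=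
    ⟨_, rfl⟩
  induction N using Nat.strong_induction_on generalizing D f with
  | _ N ih =>
    have hp : (4 : ℤ) ≤ 2 ^ (2 * (k + 1)) := by
      calc (4 : ℤ) = 2 ^ 2 := by norm_num
        _ ≤ 2 ^ (2 * (k + 1)) := pow_le_pow_right₀ (by norm_num) (by omega)
    obtain ⟨n, hn⟩ : ∃ n : ℕ, n + 3 = 2 ^ (2 * (k + 1)) :=
      ⟨2 ^ (2 * (k + 1)) - 3, Nat.sub_add_cancel (by zify; omega)⟩
    have hn' : (2 : ℤ) ^ (2 * (k + 1)) = n + 3 := by exact_mod_cast hn.symm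
    obtain ⟨e3, e2, e1⟩ := ev_four_pow hn
    have hx0 := h0 0
    have hy0 := h0 1
    have hpath := (path_zero_full (by omega) hx0 (h0 _) (one_le_full h0)).trans
      (h.path_zeroed (by omega) hx0 (by omega) (by omega) hy (h0 _) (one_le_full h0))
    have hlf := h.le
    have h0' := bump_nonneg h0 f
    rcases f with _ | _ | f
    · obtain ⟨s, u, hu⟩ := exists_pow_mul_odd (show D 0 + 1 ≠ 0 by omega)
      have hs : s < 2 * (k + 1) := lt_of_pow_mul_odd_le hu (by omega) (by omega)
      have b0 : bump D 0 0 = D 0 + 1 := by simp [bump]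
      have b1 : bump D 0 1 = D 1 := by simp [bump]
      -- Raising `D 0` beyond `n + 1` would require `ev (D 1) = ev (n + 1) + 1`, more than `D 1 ≤ n
      -- + 2` permits.
      have hx' : D 0 + 3 ≤ 2 ^ (2 * (k + 1)) := by
        by_contra hc
        have hD : (D 0).toNat = n + 1 := by omega
        have := ev_mono (show (D 1).toNat ≤ n + 2 by omega)
        rw [hev, hD, if_pos Even.zero] at this
        omega
      have hev' := ev_succ (n := (D 0).toNat) (s := s) (u := u) (by omega)
      have hm : (2 * 2 ^ (2 * (k + 1)) - bump D 0 0 - bump D 0 1).toNat * (2 * k + 4) + s < N := by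
        rw [hN, b0, b1]
        have : (2 * 2 ^ (2 * (k + 1)) - D 0 - D 1).toNat
            = (2 * 2 ^ (2 * (k + 1)) - (D 0 + 1) - D 1).toNat + 1 := by omega
        rw [this, add_mul]
        omega
      have he : ev (bump D 0 1).toNat = ev (bump D 0 0).toNat + if Even s then 1 else 0 := by
        rw [b0, b1, hev, if_pos Even.zero, show (D 0 + 1).toNat = (D 0).toNat + 1 by omega, hev']
        rcases Nat.even_or_odd s with hs | hs
        · rw [if_neg (Nat.not_odd_iff_even.2 hs), if_pos hs]
        · rw [if_pos hs, if_neg (Nat.not_even_iff_odd.2 hs)]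
      obtain ⟨D', p, q⟩ := ih _ hm (h.bump_zero hu (by omega)) h0' (by omega) (by omega) he rfl
      exact ⟨D', hpath.trans p, q⟩
    · obtain ⟨s, u, hu⟩ := exists_pow_mul_odd (show D 1 + 1 ≠ 0 by omega)
      have b0 : bump D 1 0 = D 0 := by simp [bump]
      have b1 : bump D 1 1 = D 1 + 1 := by simp [bump]
      have hev' := ev_succ (n := (D 1).toNat) (s := s) (u := u) (by omega)
      rw [zero_add, if_neg (by decide)] at hev
      rcases (show D 1 + 1 ≤ 2 ^ (2 * (k + 1)) by omega).lt_or_eq with hlt | heq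
      · have hs : s < 2 * (k + 1) := lt_of_pow_mul_odd_le hu (by omega) (by omega)
        have hm : (2 * 2 ^ (2 * (k + 1)) - bump D 1 0 - bump D 1 1).toNat * (2 * k + 4) + (s + 1)
            < N := by
          rw [hN, zero_add, b0, b1]
          have : (2 * 2 ^ (2 * (k + 1)) - D 0 - D 1).toNat
              = (2 * 2 ^ (2 * (k + 1)) - D 0 - (D 1 + 1)).toNat + 1 := by omega
          rw [this, add_mul]
          omega
        have he : ev (bump D 1 1).toNat
            = ev (bump D 1 0).toNat + if Even (s + 1) then 1 else 0 := by
          rw [b0, b1, show (D 1 + 1).toNat = (D 1).toNat + 1 by omega, hev', hev]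
          rcases Nat.even_or_odd s with hs | hs
          · rw [if_neg (Nat.not_odd_iff_even.2 hs), if_neg (by simpa [Nat.even_add_one] using hs)]
          · rw [if_pos hs, if_pos hs.add_one]
        obtain ⟨D', p, q⟩ := ih _ hm (h.bump_one hu (by omega)) h0' (by omega) (by omega) he rfl
        exact ⟨D', hpath.trans p, q⟩
      · have hs : s = 2 * (k + 1) :=
          pow_mul_odd_unique (u := u) (v := 0) (by rw [← hu, heq]; ring)
        subst hs
        refine ⟨_, hpath, h0', (h.bump_one hu le_rfl).isLast (even_two_mul _) (by omega) ?_
          (b1.trans heq)⟩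
        refine b0.trans ?_
        -- Now `ev (D 0) = ev (n + 2) = ev n + 1` forces `D 0 > n`, and `hx` leaves only `n + 1`.
        have hD : (D 1).toNat = n + 2 := by omega
        rw [hD] at hev
        by_contra hc
        have := ev_mono (show (D 0).toNat ≤ n by omega)
        omega
    · have b0 : bump D (f + 2) 0 = D 0 := by simp [bump]
      have b1 : bump D (f + 2) 1 = D 1 := by simp [bump]
      have hm : (2 * 2 ^ (2 * (k + 1)) - bump D (f + 2) 0 - bump D (f + 2) 1).toNat * (2 * k + 4)
          + f < N := by
        rw [hN, b0, b1]
        omega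
      have he : ev (bump D (f + 2) 1).toNat
          = ev (bump D (f + 2) 0).toNat + if Even f then 1 else 0 := by
        rw [b0, b1, hev]
        simp [Nat.even_add]
      obtain ⟨D', p, q⟩ := ih _ hm h.bump_add_two h0' (by omega) (by omega) he rfl
      exact ⟨D', hpath.trans p, q⟩

/-! ### The rounds after Overflow -/

/-- The differences `D` after Overflow. -/
def afterOverflow (L i : ℕ) : ℤ :=
  -(if Odd i ∧ i ≤ L then 1 else 0) - if i = 1 then 1 else 0

/-- Below index `l` the parity term of `IsLast`, shifted by Halve, becomes the `-1` at odd indices.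
The additional `-1` at index `1` comes from `carry 2 (-4) = -1`. -/
theorem overflowed_eq {l : ℕ} (hl : Even l) (hl2 : 2 ≤ l) {D : ℕ → ℤ} (hD : IsLast l D) {i : ℕ}
    (hi : i ≤ l + 3) :
    overflowed (l + 2) (preOverflow l (full (l + 1) D) (2 ^ l - 2)) i
      = full (l + 3) (afterOverflow (l + 1)) i := by
  have hodd : Odd (l + 1) := hl.add_one
  rcases Nat.lt_or_ge i (l + 2) with h | h
  · rw [overflowed, if_pos h, preOverflow]
    rcases Nat.eq_zero_or_pos i with rfl | hi0
    · simp [full, base, afterOverflow]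
    obtain ⟨j, rfl⟩ := Nat.exists_eq_add_of_le' hi0
    have h1 : carry (j + 1 + 1) (2 * (2 ^ l - 2 - 2 ^ l)) = -if j + 1 = 1 then 1 else 0 := by
      rw [carry_two_mul, show (2 : ℤ) ^ l - 2 - 2 ^ l = -2 by ring]
      rcases Nat.eq_zero_or_pos j with rfl | hj
      · rfl
      · rw [carry_eq_zero_of_lt (n := 1) (by omega) (by norm_num) (by norm_num), if_neg (by omega)]
        rfl
    rw [if_neg (by omega), h1, carry_pow_sub_one (by omega) (by omega), full, afterOverflow]
    generalize (if j + 1 = 1 then (1 : ℤ) else 0) = δ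
    have hb : base (l + 3) (j + 1) = 2 ^ (l + 3 - (j + 1)) := by rw [base, if_pos (by omega)]
    rw [hb]
    rcases Nat.lt_or_ge (j + 1) l with h2 | h2
    · obtain ⟨r, rfl⟩ := Nat.exists_eq_add_of_lt h2
      have e1 : j + 1 + r + 1 + 1 - (j + 1 + 1) = r + 1 := by omega
      have e2 : j + 1 + r + 1 + 2 - (j + 1) = r + 3 := by omega
      have e3 : j + 1 + r + 1 + 3 - (j + 1) = r + 4 := by omega
      rw [zeroed, if_neg (by omega), if_pos (by omega), full, base, if_pos (by omega),
        hD.2 _ (by omega) (by omega), carry_neg_pow (by omega) (by omega), e1, e2, e3]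
      rcases Nat.even_or_odd (j + 1) with hj | hj
      · rw [if_neg (by simpa [Nat.even_add_one] using hj),
          if_neg (fun h => Nat.not_even_iff_odd.2 h.1 hj)]
        ring
      · rw [if_pos hj.add_one, if_pos ⟨hj, by omega⟩]
        ring
    · rcases h2.eq_or_lt with rfl | h2
      · have e2 : j + 1 + 2 - (j + 1) = 2 := by omega
        have e3 : j + 1 + 3 - (j + 1) = 3 := by omega
        rw [zeroed, if_neg (by omega), if_neg (by omega), if_pos rfl, full, base, if_neg (by omega),
          hD.2 _ (by omega) (by omega), carry_neg_pow (by omega) (by omega), e2, e3, Nat.sub_self,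
          if_neg (Nat.not_even_iff_odd.2 hodd), if_neg (fun h => Nat.not_even_iff_odd.2 h.1 hl)]
        ring
      · obtain rfl : j = l := by omega
        have e2 : j + 2 - (j + 1) = 1 := by omega
        have e3 : j + 3 - (j + 1) = 2 := by omega
        rw [zeroed, if_neg (by omega), if_neg (by omega), if_neg (by omega),
          carry_neg_pow_of_lt (by omega), e2, e3, if_pos ⟨hodd, le_rfl⟩]
        ring
  · have hlo : ¬ Odd (l + 2) := Nat.not_odd_iff_even.2 (hl.add even_two)
    rcases h.eq_or_lt with rfl | h
    · have h2 : carry (l + 2 + 1) (2 * (2 ^ l - 2 - 2 ^ l)) = 0 := by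
        rw [show (2 : ℤ) * (2 ^ l - 2 - 2 ^ l) = -4 by ring]
        exact carry_eq_zero_of_lt (n := 2) (by omega) (by norm_num) (by norm_num)
      have e : l + 3 - (l + 2) = 1 := by omega
      rw [overflowed, if_neg (by omega), if_pos rfl, preOverflow, if_neg (by omega), h2,
        carry_neg_pow_of_lt (by omega), carry_pow_sub_one (by omega) le_rfl, zeroed,
        if_neg (by omega), if_neg (by omega), if_neg (by omega), full, base, if_pos (by omega),
        afterOverflow, if_neg (fun h => hlo h.1), if_neg (by omega), e, Nat.sub_self]
      norm_num
    · rw [overflowed, if_neg (by omega), if_neg (by omega), full, base, if_neg (by omega),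
        afterOverflow, if_neg (by omega), if_neg (by omega)]
      rfl

theorem zeroed_congr {L : ℕ} {a b : ℕ → ℤ} (h : ∀ i ≤ L, a i = b i) : zeroed L a = zeroed L b := by
  funext i
  simp only [zeroed]
  rw [h 0 (by omega), h L le_rfl]
  split_ifs with h1 h2 <;> first | rfl | exact h i (by omega)

theorem path_overflow_round {l : ℕ} (hl : Even l) (hl2 : 2 ≤ l) {D : ℕ → ℤ} (hD : IsLast l D)
    (h0 : ∀ i, 0 ≤ D i) :
    Path 1 (st (l + 1) (full (l + 1) D))
      (st (l + 5) (zeroed (l + 3) (full (l + 3) (afterOverflow (l + 1))))) := by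
  have hp := h0 0
  rw [hD.1] at hp
  have h1 := path_zero_full hl2 (h0 0) (h0 _) (one_le_full h0)
  have h2 : Path 1 _ _ := path_preOverflow (l := l) (e := full (l + 1) D) (x := 2 ^ l - 2)
    (by omega) (fun i _ => even_full _ _ i) (by rw [full_zero, hD.1]) ?_ hp (by omega) ?_
    (one_le_full h0)
  · rw [zeroed_congr fun i => overflowed_eq hl hl2 hD] at h2
    exact h1.trans h2
  · rw [full, base, if_pos (by omega), hD.2 1 le_rfl (by omega), if_neg (by decide),
      Nat.add_sub_cancel]
    ring
  · have := h0 (l + 1)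
    rw [full, base, if_neg (by omega)]
    omega

/-- Shifting the row of `-1`s down by two clears its uppermost place `l + 1`; `carry 1 (-2) = -1`
preserves the extra `-1` at index `1`. -/
theorem inv_afterOverflow {l : ℕ} (hl : Even l) (hl2 : 2 ≤ l) :
    Inv (l + 3) (afterOverflow (l + 1)) (l + 1) := by
  refine ⟨fun i hi => ?_, by omega, fun i hi => ?_⟩
  · have a0 : afterOverflow (l + 1) 0 = 0 := by simp [afterOverflow]
    have a1 : afterOverflow (l + 1) 1 = -2 := by simp [afterOverflow]
    have hc : carry i (-2) = -if i = 1 then 1 else 0 := by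
      rcases i with _ | _ | i
      · rfl
      · rfl
      · rw [carry_eq_zero_of_lt (n := 1) (by omega) (by norm_num) (by norm_num), if_neg (by omega)]
        rfl
    have he : Odd (i + 2) ↔ Odd i := by simp [Nat.odd_add]
    have h2 : afterOverflow (l + 1) (i + 2) = -if Odd i ∧ i + 2 ≤ l + 1 then 1 else 0 := by
      simp [afterOverflow, he]
    rw [next, bump, a0, a1, hc, carry_zero, h2,
      if_neg (show ¬ (i = l + 3 ∧ (0 : ℤ) ≤ -2) by omega), afterOverflow]
    generalize (if i = 1 then (1 : ℤ) else 0) = δ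
    by_cases ho : Odd i
    · have hne : i ≠ l := fun h => Nat.not_odd_iff_even.2 hl (h ▸ ho)
      rcases lt_trichotomy i (l + 1) with h | rfl | h
      · rw [if_pos ⟨ho, by omega⟩, if_pos ⟨ho, by omega⟩, if_neg (by omega)]
        ring
      · rw [if_neg (by omega), if_pos ⟨ho, by omega⟩, if_pos rfl]
        ring
      · rw [if_neg (by omega), if_neg (by omega), if_neg (by omega)]
        ring
    · have hne : i ≠ l + 1 := fun h => ho (h ▸ hl.add_one)
      rw [if_neg (fun h => ho h.1), if_neg (fun h => ho h.1), if_neg hne]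
      ring
  · rw [afterOverflow, if_neg (by omega), if_neg (by omega)]
    rfl

theorem one_le_full_bump {L f : ℕ} {D : ℕ → ℤ} (h : ∀ i, 1 ≤ i → i < L → 1 ≤ full L D i) (i : ℕ)
    (hi : 1 ≤ i) (hi' : i < L) : 1 ≤ full L (bump D f) i := by
  have := h i hi hi'
  rw [full] at *
  rw [bump]
  split_ifs <;> omega

/-- Without carries, and with the two extra ones at `L` cancelling, `Inv` reads `D i = D (i + 2)`.
-/
theorem Inv.eq_zero {L : ℕ} {D : ℕ → ℤ} (h : Inv L D L) (h0 : D 0 = 0) (h1 : D 1 = 0) : D = 0 := by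
  have key : ∀ j i, L + 1 ≤ i + j → D i = 0 := by
    intro j
    induction j with
    | zero => exact fun i hi => h.supp i (by omega)
    | succ j ih =>
      intro i hi
      rcases Nat.lt_or_ge L i with h' | h'
      · exact h.supp i h'
      · have := h.next_eq i h'
        rw [next, bump, h0, h1, carry_zero, carry_zero, ih (i + 2) (by omega)] at this
        simpa using this.symm
  funext i
  exact key (L + 1) i (by omega)

/-- As `f` stays odd, `D 0` is never touched. Raising `D 1` from `-2` to `-1` gives `f = 1` again,
since the new value is odd; raising it to `0` sends `f` to the top, and then all differences vanish.
-/
theorem path_zeroed_zero {l f : ℕ} (hl : 2 ≤ l) {D : ℕ → ℤ} (h : Inv (l + 1) D f) (hf : Odd f)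
    (hx : D 0 = 0) (hy : D 1 = -2 ∨ D 1 = -1) (htop : 0 ≤ D (l + 1))
    (hpos : ∀ i, 1 ≤ i → i < l + 1 → 1 ≤ full (l + 1) D i) :
    Path 0 (st (l + 3) (zeroed (l + 1) (full (l + 1) D))) (st (l + 1) (full (l + 1) 0)) := by
  obtain ⟨N, hN⟩ : ∃ N : ℕ, N = (-D 1).toNat * (l + 2) + f := ⟨_, rfl⟩
  induction N using Nat.strong_induction_on generalizing D f with
  | _ N ih =>
    have hp : (4 : ℤ) ≤ 2 ^ l := by
      calc (4 : ℤ) = 2 ^ 2 := by norm_num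
        _ ≤ 2 ^ l := pow_le_pow_right₀ (by norm_num) (by omega)
    have h1 := h.path_zeroed hl (by omega) (by omega) (by omega) (by omega) htop hpos
    have htop' : 0 ≤ bump D f (l + 1) := by rw [bump]; split_ifs <;> omega
    have hpos' := one_le_full_bump (f := f) hpos
    have b0 : bump D f 0 = 0 := by
      obtain ⟨r, rfl⟩ := hf
      simp [bump, hx]
    have h2 := h1.trans (path_zero_full hl b0.ge htop' hpos')
    rcases f with _ | _ | f
    · exact absurd hf (by decide)
    · have b1 : bump D 1 1 = D 1 + 1 := by simp [bump]
      rcases hy with hy | hy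
      · have h3 : Inv (l + 1) (bump D 1) (0 + 1) :=
          h.bump_one (s := 0) (u := -1) (by rw [hy]; norm_num) (by omega)
        exact h2.trans (ih _ (by rw [hN, zero_add, b1, hy]; simp) h3 odd_one b0
          (by rw [zero_add]; omega) htop' hpos' rfl)
      · have h3 := h.bump_one_top hy
        rw [zero_add] at b0 h1
        rwa [h3.eq_zero b0 (by omega)] at h1
    · have b1 : bump D (f + 2) 1 = D 1 := by simp [bump]
      have hm : (-bump D (f + 2) 1).toNat * (l + 2) + f < N := by
        rw [hN, b1]
        omega
      rw [← b1] at hy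
      exact h2.trans (ih _ hm h.bump_add_two (by simpa [Nat.odd_add] using hf) b0 hy htop' hpos' rfl)

/-! ### From `S_k` to `S_{k+1}` -/

theorem counterState_eq (k : ℕ) : counterState k = st (2 * k + 1) (full (2 * k + 1) 0) := by
  rw [st_eq_cons_append_singleton]
  have : (List.map (fun j => (2 : ℤ) ^ (j + 1)) (List.range (2 * k))).reverse =
      (List.range (2 * k)).map fun i => full (2 * k + 1) 0 (i + 1) := by
    apply List.ext_getElem
    · simp
    · intro i hi hi'
      have h : i < 2 * k := by simpa using hi
      simp [full, base, h]
      omega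
  simp only [counterState, List.reverse_append, this]
  simp [full, base]

theorem path_counterState (k : ℕ) :
    Path 1 (counterState (k + 1)) (counterState (k + 2)) := by
  have hl := even_two_mul (k + 1)
  have hl2 : 2 ≤ 2 * (k + 1) := by omega
  obtain ⟨D, h1, h0, hD⟩ := exists_path_isLast k (inv_zero _) (fun _ => le_rfl)
    (by
      have : (2 : ℤ) ^ 1 ≤ 2 ^ (2 * (k + 1)) := pow_le_pow_right₀ (by norm_num) (by omega)
      simpa using this)
    (by simp) (by simp)
  have h2 := path_overflow_round hl hl2 hD h0
  have h3 := path_zeroed_zero (l := 2 * (k + 1) + 2) (by omega) (inv_afterOverflow hl hl2)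
    hl.add_one (by simp [afterOverflow]) (by simp [afterOverflow]) (by
      rw [afterOverflow, if_neg (by omega), if_neg (by omega)]; rfl) ?_
  · rw [counterState_eq, counterState_eq]
    exact (h1.trans h2).trans h3
  · intro i hi hi'
    rw [full, base, if_pos ⟨hi, hi'⟩, afterOverflow]
    rcases Nat.lt_or_ge (2 * (k + 1) + 1) i with h | h
    · have : (0 : ℤ) < 2 ^ (2 * (k + 1) + 2 + 1 - i) := by positivity
      rw [if_neg (by omega), if_neg (by omega)]
      omega
    · rcases hi.eq_or_lt with rfl | hi
      · have : (2 : ℤ) ^ 4 ≤ 2 ^ (2 * (k + 1) + 2 + 1 - 1) :=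
          pow_le_pow_right₀ (by norm_num) (by omega)
        split_ifs <;> omega
      · have : (2 : ℤ) ^ 2 ≤ 2 ^ (2 * (k + 1) + 2 + 1 - i) :=
          pow_le_pow_right₀ (by norm_num) (by omega)
        split_ifs <;> omega

theorem not_halts_counterState (k : ℕ) : ¬ Halts P (counterState (k + 1)) := by
  refine not_halts_of_chain (fun k => counterState (k + 1)) (fun k => ?_) k
  obtain ⟨⟨m, hm, -⟩, -⟩ := path_counterState k
  refine ⟨m, Nat.pos_of_ne_zero ?_, hm⟩
  rintro rfl
  have := congrArg List.length (Option.some_injective _ hm)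
  simp [counterState] at this

/-! ### The machine does not halt -/

theorem Reach.halts {c d : Cfg} (h : Reach c d) (hc : Halts step c) : Halts step d := by
  obtain ⟨m, hm⟩ := h
  obtain ⟨n, hn⟩ := hc
  refine ⟨n, ?_⟩
  have h1 : iter step (m + n) c = iter step n d := by rw [iter_add, hm]; rfl
  rw [← h1, add_comm, iter_add, hn]
  rfl

theorem getI_lblk (n : ℕ) (t : List Bool) : (lblk n ++ true :: t).getI (2 * n) = true := by
  induction n with
  | zero => rfl
  | succ n ih => exact ih

theorem getI_lblk_of_lt {m n : ℕ} (h : n < m) (t : List Bool) :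
    (lblk m ++ t).getI (2 * n) = false := by
  induction n generalizing m with
  | zero =>
    obtain ⟨m, rfl⟩ := Nat.exists_eq_add_of_lt h
    rfl
  | succ n ih =>
    obtain ⟨m, rfl⟩ := Nat.exists_eq_add_of_le' (show 1 ≤ m by omega)
    exact ih (by omega)

theorem exists_conf_counterState (k : ℕ) : ∃ t : List Bool,
    conf (counterState (k + 1)) = mr .B (true :: (lblk (2 ^ (2 * (k + 1))) ++ true :: t)) [] := by
  have e : counterState (k + 1) = 0 :: 2 ^ (2 * (k + 1)) ::
      st (2 * k + 1) fun i => full (2 * (k + 1) + 1) 0 (i + 1 + 1) := by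
    rw [counterState_eq, show 2 * (k + 1) + 1 = 2 * k + 1 + 1 + 1 by ring, st_succ, st_succ]
    simp [full, base]
    ring
  rw [e, conf_cons (by norm_num), st_succ]
  have h : ((2 : ℤ) ^ (2 * (k + 1))).toNat = 2 ^ (2 * (k + 1)) := by
    exact_mod_cast Int.toNat_natCast (2 ^ (2 * (k + 1)))
  simp only [tapeWord, h]
  exact ⟨_, rfl⟩

/-- This makes the machine runs between milestones nonempty. The tapes differ at the separator
behind the shorter second block; the `+ 1` in the cell index counts the separator before that block.
-/
theorem conf_counterState_ne (k : ℕ) :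
    conf (counterState (k + 1)) ≠ conf (counterState (k + 2)) := by
  obtain ⟨t, ht⟩ := exists_conf_counterState k
  obtain ⟨t', ht'⟩ := exists_conf_counterState (k + 1)
  rw [ht, ht']
  intro h
  have h1 := congrArg (fun c : Cfg => c.tape.left.nth (2 * 2 ^ (2 * (k + 1)) + 1)) h
  have h2 : (lblk (2 ^ (2 * (k + 1))) ++ true :: t).getI (2 * 2 ^ (2 * (k + 1))) =
      (lblk (2 ^ (2 * (k + 1 + 1))) ++ true :: t').getI (2 * 2 ^ (2 * (k + 1))) := h1
  rw [getI_lblk, getI_lblk_of_lt (pow_lt_pow_right₀ (by norm_num) (by omega))] at h2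
  exact absurd h2 (by decide)

/-- The blank start and the configuration of `S_1` run into a common configuration, so halting from
the first would mean halting from the second. -/
theorem not_halts_initial : ¬ Halts step initial := by
  intro h
  have h1 : Path 0 (counterState 1) [-1, 4, 2, 1, 0, 0] := by
    have := path_zero_full (l := 2) (D := 0) le_rfl le_rfl le_rfl (one_le_full fun _ => le_rfl)
    rw [← counterState_eq 1] at this
    have e : st (2 + 3) (zeroed (2 + 1) (full (2 + 1) 0)) = [-1, 4, 2, 1, 0, 0] := by decide
    rwa [e] at this
  refine not_halts_of_chain (fun k => conf (counterState (k + 1))) (fun k => ?_) 0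
    (?_ : Halts step (conf (counterState 1)))
  · obtain ⟨-, m, hm⟩ := path_counterState k
    refine ⟨m, Nat.pos_of_ne_zero ?_, hm⟩
    rintro rfl
    exact conf_counterState_ne k (Option.some_injective _ hm)
  · obtain ⟨n, hn⟩ := reach_initial.halts h
    obtain ⟨-, m, hm⟩ := h1
    exact ⟨m + n, by rw [iter_add, hm]; exact hn⟩

end Skelet17

theorem theorem1 :
    (∀ k : ℕ, 1 ≤ k → ∃ m : ℕ,
      Skelet17.iter Skelet17.P m (Skelet17.counterState k)
          = some (Skelet17.counterState (k + 1)) ∧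
      (Skelet17.rulesApplied m (Skelet17.counterState k)).count Skelet17.Rule.overflow = 1) ∧
    (∀ k : ℕ, 1 ≤ k → ¬ Skelet17.Halts Skelet17.P (Skelet17.counterState k)) ∧
    ¬ Skelet17.Halts Skelet17.step Skelet17.initial := by
  refine ⟨fun k hk => ?_, fun k hk => ?_, Skelet17.not_halts_initial⟩ <;>
    obtain ⟨k, rfl⟩ := Nat.exists_eq_add_of_le' hk
  · exact (Skelet17.path_counterState k).1
  · exact Skelet17.not_halts_counterState k
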